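/- Let $X\subset\mathbb{C}^n$ be a domain (a non-empty open connected set) and let $\mathrm{Aut}(X)$ be the set of biholomorphic self-maps of $X$. Let $K:X\times X\to\mathbb{C}$ be holomorphic in the first variable and antiholomorphic in the second, non-degenerate (i.e. $K(x,x)>0$ for every $x\in X$) and positive semi-definite (i.e. every matrix $(K(x_i,x_j))_{i,j}$ with $x_1,\dots,x_m\in X$ is positive semi-definite). Let $F$ be the reproducing kernel Hilbert space of functions on $X$ with kernel $K$, let $F^*$ be its dual with the dual inner product (linear in the first variable), so that $F^*$ is again a Hilbert space, and let $\kappa:X\to F^*$ be the evaluation map $\kappa(x)f=f(x)$, so that $\langle\kappa(x),\kappa(y)\rangle_{F^*}=K(x,y)$. For $x\in X$ and $u,v\in T_xX=\mathbb{C}^n$ put $$\tilde\sigma^K_x(u,v)=\frac{\langle D\kappa_x u,D\kappa_x v\rangle}{\|\kappa(x)\|^2}-\frac{\langle D\kappa_x u,\kappa(x)\rangle\langle\kappa(x),D\kappa_x v\rangle}{\|\kappa(x)\|^4}$$ (the pull-back of the Fubini–Study metric via $\kappa$), and for $x,y\in X$ put $$\delta_1^K(x,y)=\sqrt{1-\frac{|\langle\kappa(x),\kappa(y)\rangle|^2}{\|\kappa(x)\|^2\|\kappa(y)\|^2}},\qquad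 \delta_2^K(x,y)=\sqrt{2-2\frac{|\langle\kappa(x),\kappa(y)\rangle|}{\|\kappa(x)\|\,\|\kappa(y)\|}}.$$ The following are equivalent: (i) $K$ is projectively invariant, i.e. for every $\Phi\in\mathrm{Aut}(X)$ there is a function $\omega:X\to\mathbb{C}$ with $K(\Phi(x),\Phi(y))=\omega(x)\overline{\omega(y)}K(x,y)$ for all $x,y\in X$; (ii) for every $\Phi\in\mathrm{Aut}(X)$ there is a function $\omega:X\to\mathbb{C}$ such that the weighted composition operator $W_{\omega,\Phi}f=\omega\cdot(f\circ\Phi)$ is well defined on $F$ and is a unitary operator on $F$; (iii$_0$) $\tilde\sigma^K$ is automorphism-invariant, i.e. $\tilde\sigma^K_{\Phi(x)}(D\Phi_xu,D\Phi_xv)=\tilde\sigma^K_x(u,v)$ for all $\Phi\in\mathrm{Aut}(X)$, $x\in X$ and $u,v\in\mathbb{C}^n$; (iii$_1$) $\delta_1^K$ is automorphism-invariant, i.e. $\delta_1^K(\Phi(x),\Phi(y))=\delta_1^K(x,y)$ for all $\Phi\in\mathrm{Aut}(X)$ and $x,y\in X$; (iii$_2$) $\delta_2^K$ is automorphism-invariant,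 in the same sense; (iv) for every $\Phi\in\mathrm{Aut}(X)$ there are $y\in X$ and a non-empty open set $U\subset X$ such that for every $x\in U$ $$\frac{|K(\Phi(x),\Phi(y))|^2}{K(\Phi(x),\Phi(x))K(\Phi(y),\Phi(y))}=\frac{|K(x,y)|^2}{K(x,x)K(y,y)}.$$ -/

import Mathlib

open scoped ComplexOrder ComplexConjugate

noncomputable section

namespace ProjectiveKernel

section Domain

variable {n : ℕ} {X : Set (EuclideanSpace ℂ (Fin n))}

/-- Extension by zero of a map on `X` to all of `ℂⁿ`; only its values on `X` (and, `X` being open,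
its germs at points of `X`) are ever used. -/
def ext {V : Type*} [Zero V] (f : X → V) : EuclideanSpace ℂ (Fin n) → V :=
  Function.extend Subtype.val f 0

/-- `f : X → V` is holomorphic, for `X` open in `ℂⁿ` and `V` a complex normed space. -/
def IsHolomorphic {V : Type*} [NormedAddCommGroup V] [NormedSpace ℂ V] (f : X → V) : Prop :=
  DifferentiableOn ℂ (ext f) X

/-- The differential `D f_x : T_x → V`, where `T_x = T_x^{1,0} X` is identified with `ℂⁿ`. -/
def differential {V : Type*} [NormedAddCommGroup V] [NormedSpace ℂ V] (f : X → V) (x : X) :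
    EuclideanSpace ℂ (Fin n) →L[ℂ] V :=
  fderiv ℂ (ext f) x

/-- `Φ` is an automorphism (a biholomorphic self-map) of `X`. -/
def IsAutomorphism (Φ : X ≃ X) : Prop :=
  IsHolomorphic (fun x => (Φ x : EuclideanSpace ℂ (Fin n))) ∧
    IsHolomorphic (fun x => (Φ.symm x : EuclideanSpace ℂ (Fin n)))

/-- Holomorphic in the first variable, antiholomorphic in the second. -/
def IsSesquiHolomorphic (L : X → X → ℂ) : Prop :=
  (∀ y, IsHolomorphic (fun x => L x y)) ∧ ∀ x, IsHolomorphic (fun y => conj (L x y))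

end Domain

section Kernels

variable {X : Type*}

/-- `L x x` is real and positive for all `x`. -/
def IsNondegenerate (L : X → X → ℂ) : Prop := ∀ x, 0 < L x x

def IsPosSemidefKernel (K : X → X → ℂ) : Prop :=
  ∀ (m : ℕ) (x : Fin m → X), (Matrix.of fun i j => K (x i) (x j)).PosSemidef

/-- `M` is a rescaling of `L`. -/
def IsRescaling (M L : X → X → ℂ) : Prop :=
  ∃ ω : X → ℂ, ∀ x y, M x y = ω x * conj (ω y) * L x y

/-- `|L (x, y)|² / (L (x, x) L (y, y))`. -/
def normalizedSq (L : X → X → ℂ) (x y : X) : ℂ :=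
  ((‖L x y‖ ^ 2 : ℝ) : ℂ) / (L x x * L y y)

end Kernels

section Dual

variable {F : Type*} [NormedAddCommGroup F] [InnerProductSpace ℂ F] [CompleteSpace F]

/-- The inner product of `F*`, linear in the first variable `f`: Riesz representation is antilinear
and Mathlib's `inner` is antilinear in its first argument. -/
def dualInner (f h : StrongDual ℂ F) : ℂ :=
  inner ℂ ((InnerProductSpace.toDual ℂ F).symm f) ((InnerProductSpace.toDual ℂ F).symm h)

/-- The (degenerate) Fubini–Study metric at `g ∈ F* \ {0}`. -/
def fubiniStudy (g f h : StrongDual ℂ F) : ℂ :=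
  dualInner f h / (‖g‖ : ℂ) ^ 2 - dualInner f g * dualInner g h / (‖g‖ : ℂ) ^ 4

def delta₁ (g h : StrongDual ℂ F) : ℝ :=
  Real.sqrt (1 - ‖dualInner g h‖ ^ 2 / (‖g‖ ^ 2 * ‖h‖ ^ 2))

def delta₂ (g h : StrongDual ℂ F) : ℝ :=
  Real.sqrt (2 - 2 * (‖dualInner g h‖ / (‖g‖ * ‖h‖)))

end Dual

section RKHS

variable {X : Type*} (F : Type*) [NormedAddCommGroup F] [InnerProductSpace ℂ F] [CompleteSpace F]
  [RKHS ℂ F X ℂ]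

/-- The scalar function `K` is the reproducing kernel of `F`: `K (x, y) = K_y (x)`. -/
def HasKernel (K : X → X → ℂ) : Prop :=
  ∀ x y, K x y = RKHS.kerFun F y (1 : ℂ) x

/-- The evaluation map `κ (x) = K_x^* ∈ F*`, i.e. `κ (x) f = f (x)`. -/
def evalMap (x : X) : StrongDual ℂ F :=
  InnerProductSpace.toDual ℂ F (RKHS.kerFun F x (1 : ℂ))

theorem evalMap_apply (x : X) (f : F) : evalMap F x f = f x := by
  simp [evalMap]

/-- The weighted composition operator `W_{ω,Φ} f = ω · (f ∘ Φ)` is well defined on `F` and equal to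
the bounded operator `W`. -/
def IsWeightedComposition (W : F →L[ℂ] F) (ω : X → ℂ) (Φ : X → X) : Prop :=
  ∀ (f : F) (x : X), (W f) x = ω x * f (Φ x)

end RKHS

section Existence

universe u

/-- Every positive semi-definite kernel has a reproducing kernel Hilbert space (Moore–Aronszajn),
so that `HasKernel` is satisfiable for all kernels in question. -/
theorem exists_hasKernel {X : Type u} (K : X → X → ℂ) (hK : IsPosSemidefKernel K) :
    ∃ (F : Type u) (_ : NormedAddCommGroup F) (_ : InnerProductSpace ℂ F) (_ : CompleteSpace F)
      (_ : RKHS ℂ F X ℂ), HasKernel F K := by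
  let M : Matrix X X (ℂ →L[ℂ] ℂ) := Matrix.of fun x y => K x y • ContinuousLinearMap.id ℂ ℂ
  have hMa : ∀ x y z, M x y z = K x y * z := fun x y z => by simp [M]
  have herm : ∀ x y, conj (K x y) = K y x := fun x y => by
    have := (hK 2 ![x, y]).1.apply 1 0
    simpa using this
  have hM : M.PosSemidef := by
    have key : M.IsHermitian ∧ ∀ (vv : X →₀ ℂ),
        0 ≤ RCLike.re (vv.sum fun x w ↦ vv.sum fun x' w' ↦ inner ℂ (M x' x w) w') := by
      refine ⟨?_, fun vv => ?_⟩
      · ext x y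
        refine ext_inner_right ℂ fun w => ?_
        rw [Matrix.conjTranspose_apply, ContinuousLinearMap.star_eq_adjoint,
          ContinuousLinearMap.adjoint_inner_left, hMa, hMa]
        simp [herm, mul_comm]
      · have h := hK _ (fun i => (vv.support.equivFin.symm i : X))
        have h2 := h.dotProduct_mulVec_nonneg (fun i => vv (vv.support.equivFin.symm i : X))
        have h3 := (Complex.le_def.1 h2).1
        simp only [Complex.zero_re, dotProduct, Matrix.mulVec, Finset.mul_sum,
          Matrix.of_apply] at h3
        refine h3.trans_eq ?_
        change Complex.re _ = Complex.re _
        congr 1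
        simp only [Finsupp.sum, hMa]
        rw [Finset.sum_comm]
        conv_rhs => rw [← Finset.sum_coe_sort, ← Equiv.sum_comp vv.support.equivFin.symm]
        rw [Finset.sum_comm]
        refine Finset.sum_congr rfl fun i _ => ?_
        conv_rhs => rw [← Finset.sum_coe_sort, ← Equiv.sum_comp vv.support.equivFin.symm]
        refine Finset.sum_congr rfl fun j _ => ?_
        simp [herm]
        ring
    exact (RKHS.posSemidef_tfae.out 0 2).2 key
  have : Fact M.PosSemidef := ⟨hM⟩
  refine ⟨RKHS.OfKernel M, inferInstance, inferInstance, inferInstance, inferInstance, ?_⟩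
  intro x y
  rw [RKHS.kerFun_apply, RKHS.OfKernel.kernel_ofKernel, hMa, mul_one]

end Existence

section PullBack

variable {n : ℕ} {X : Set (EuclideanSpace ℂ (Fin n))} (F : Type*) [NormedAddCommGroup F]
  [InnerProductSpace ℂ F] [CompleteSpace F] [RKHS ℂ F X ℂ]

/-- The pull-back `σ̃^K_x (u, v)` of the Fubini–Study metric through `κ`, for `u, v ∈ T_x`. -/
def pullbackFubiniStudy (x : X) (u v : EuclideanSpace ℂ (Fin n)) : ℂ :=
  fubiniStudy (evalMap F x) (differential (evalMap F) x u) (differential (evalMap F) x v)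

/-- The pull-back `δ₁^K`. -/
def pullbackDelta₁ (x y : X) : ℝ := delta₁ (evalMap F x) (evalMap F y)

/-- The pull-back `δ₂^K`. -/
def pullbackDelta₂ (x y : X) : ℝ := delta₂ (evalMap F x) (evalMap F y)

end PullBack

section Invariance

variable {n : ℕ} {X : Set (EuclideanSpace ℂ (Fin n))}

def IsProjectivelyInvariant (L : X → X → ℂ) : Prop :=
  ∀ Φ : X ≃ X, IsAutomorphism Φ → IsRescaling (fun x y => L (Φ x) (Φ y)) L

/-- A field of forms `σ_x` on the tangent spaces `T_x` is automorphism-invariant: `Φ^* σ = σ`. -/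
def IsAutInvariantForm
    (σ : X → EuclideanSpace ℂ (Fin n) → EuclideanSpace ℂ (Fin n) → ℂ) : Prop :=
  ∀ Φ : X ≃ X, IsAutomorphism Φ → ∀ (x : X) (u v : EuclideanSpace ℂ (Fin n)),
    σ (Φ x) (differential (fun z => (Φ z : EuclideanSpace ℂ (Fin n))) x u)
      (differential (fun z => (Φ z : EuclideanSpace ℂ (Fin n))) x v) = σ x u v

/-- A (pseudo)distance on `X` is automorphism-invariant. -/
def IsAutInvariantDist (d : X → X → ℝ) : Prop :=
  ∀ Φ : X ≃ X, IsAutomorphism Φ → ∀ x y, d (Φ x) (Φ y) = d x y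

end Invariance

end ProjectiveKernel

end

/-!
The form `σ̃` and the distances `δ₁`, `δ₂` depend on `κ` only up to an isometry and a scalar
function, so the point is to recover `κ` from them. The holomorphy of `κ` itself comes from a
Hartogs-type argument: `K` is only separately holomorphic, and the mean value inequality for
`log ‖·‖` yields a local bound on `κ`.

Equality of `σ̃` and its pull-back by `Φ` polarizes along complex lines to an identity between
logarithmic derivatives of quotients of Gram kernels; integrating it, one recovers the angles
between the lines spanned by `κ x` and `κ y` for nearby points. Conversely, if the angles of `κ x`
and `κ (Φ x)` with the fixed vectors `κ y` and `κ (Φ y)` agree for `x` in an open set `U`, then on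
`U` suitable holomorphic multiples of the two curves have equal norms, hence by polarization equal
Gram kernels, hence differ by a unitary operator. Analytic continuation carries proportionality up
to this operator from `U` to `X`.
-/

namespace ProjectiveKernel

section DualInner

open InnerProductSpace

variable {F : Type*} [NormedAddCommGroup F] [InnerProductSpace ℂ F] [CompleteSpace F]

theorem dualInner_eq_apply (f h : StrongDual ℂ F) :
    dualInner f h = f ((toDual ℂ F).symm h) := by
  rw [dualInner, toDual_symm_apply]

theorem conj_dualInner (f h : StrongDual ℂ F) : conj (dualInner f h) = dualInner h f :=
  inner_conj_symm _ _

theorem norm_dualInner_symm (f h : StrongDual ℂ F) : ‖dualInner f h‖ = ‖dualInner h f‖ :=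
  norm_inner_symm _ _

theorem norm_dualInner_le (f h : StrongDual ℂ F) : ‖dualInner f h‖ ≤ ‖f‖ * ‖h‖ := by
  simpa only [dualInner, LinearIsometryEquiv.norm_map] using
    norm_inner_le_norm (𝕜 := ℂ) ((toDual ℂ F).symm f) ((toDual ℂ F).symm h)

theorem dualInner_self (f : StrongDual ℂ F) : dualInner f f = (‖f‖ : ℂ) ^ 2 := by
  rw [dualInner, inner_self_eq_norm_sq_to_K, LinearIsometryEquiv.norm_map]
  rfl

theorem norm_dualInner_self (f : StrongDual ℂ F) : ‖dualInner f f‖ = ‖f‖ ^ 2 := by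
  simp [dualInner_self]

theorem dualInner_self_ne_zero {g : StrongDual ℂ F} (hg : g ≠ 0) : dualInner g g ≠ 0 := by
  simpa [dualInner_self] using hg

theorem continuous_dualInner :
    Continuous fun p : StrongDual ℂ F × StrongDual ℂ F => dualInner p.1 p.2 := by
  unfold dualInner
  fun_prop

theorem differentiableOn_dualInner {E : Type*} [NormedAddCommGroup E] [NormedSpace ℂ E]
    {κ : E → StrongDual ℂ F} {X : Set E} (hκ : DifferentiableOn ℂ κ X) (h : StrongDual ℂ F) :
    DifferentiableOn ℂ (fun x => dualInner (κ x) h) X := by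
  simp only [dualInner_eq_apply]
  exact hκ.clm_apply (differentiableOn_const _)

end DualInner

section SubmeanValue

open MeasureTheory Metric Set Real

theorem log_norm_le_circleAverage_posLog {g : ℂ → ℂ} {c : ℂ} {R : ℝ} (hR : R ≠ 0)
    (hg : AnalyticOnNhd ℂ g (closedBall c |R|)) :
    Real.log ‖g c‖ ≤ circleAverage (fun z => log⁺ ‖g z‖) c R := by
  rcases eq_or_ne (g c) 0 with h0 | h0
  · rw [h0, norm_zero, Real.log_zero]
    exact circleAverage_nonneg_of_nonneg fun _ _ => posLog_nonneg
  have zeros_nonneg : 0 ≤ ∑ᶠ u, (MeromorphicOn.divisor g (closedBall c |R|) u : ℝ)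
      * Real.log (R * ‖c - u‖⁻¹) := by
    refine finsum_nonneg fun u => ?_
    by_cases hu : u ∈ closedBall c |R|
    · refine mul_nonneg (mod_cast MeromorphicOn.AnalyticOnNhd.divisor_nonneg hg u) ?_
      rw [← Real.log_abs, abs_mul, abs_inv, abs_norm, ← div_eq_mul_inv]
      rcases eq_or_ne ‖c - u‖ 0 with h | h
      · rw [h, div_zero, Real.log_zero]
      · exact Real.log_nonneg ((one_le_div (by positivity)).2 (by rwa [← dist_eq_norm']))
    · simp [Function.locallyFinsuppWithin.apply_eq_zero_of_notMem _ hu]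
  have hmer := (hg.mono sphere_subset_closedBall).meromorphicOn
  calc Real.log ‖g c‖ ≤ circleAverage (fun z => Real.log ‖g z‖) c R := by
        rw [AnalyticOnNhd.circleAverage_log_norm hR hg h0]
        exact le_add_of_nonneg_left zeros_nonneg
    _ ≤ circleAverage (fun z => log⁺ ‖g z‖) c R :=
        circleAverage_mono hmer.circleIntegrable_log_norm hmer.circleIntegrable_posLog_norm
          fun z _ => le_max_right _ _

theorem ofReal_log_norm_mul_le_lintegral {g : ℂ → ℂ} (hg : AnalyticOnNhd ℂ g (closedBall 0 1)) :
    ENNReal.ofReal (Real.log ‖g 0‖) * ENNReal.ofReal (2 * π) ≤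
      ∫⁻ θ in Ioc 0 (2 * π), ENNReal.ofReal (log⁺ ‖g (Circle.exp θ)‖) := by
  have hmer : MeromorphicOn g (sphere 0 |1|) :=
    (hg.mono (by simpa using sphere_subset_closedBall)).meromorphicOn
  have hle := log_norm_le_circleAverage_posLog one_ne_zero (c := 0) (by rwa [abs_one])
  rw [circleAverage_def, smul_eq_mul, ← div_eq_inv_mul, le_div_iff₀ two_pi_pos,
    intervalIntegral.integral_of_le two_pi_pos.le] at hle
  rw [← ENNReal.ofReal_mul' two_pi_pos.le]
  refine (ENNReal.ofReal_le_ofReal hle).trans ?_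
  rw [ofReal_integral_eq_lintegral_ofReal hmer.circleIntegrable_posLog_norm.1
    (ae_of_all _ fun _ => posLog_nonneg)]
  simp [circleMap]

variable {E : Type*} [NormedAddCommGroup E] [NormedSpace ℂ E] [MeasurableSpace E] [BorelSpace E]

theorem lintegral_ball_circleAverage [SecondCountableTopology E] (μ : Measure E) [SFinite μ]
    [SMulInvariantMeasure Circle E μ] {ρ : ℝ} {f : E → ENNReal}
    (hf : Measurable ((ball 0 ρ).indicator f)) :
    ∫⁻ w in ball 0 ρ, (∫⁻ θ in Ioc 0 (2 * π), f (Circle.exp θ • w)) ∂μ =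
      ENNReal.ofReal (2 * π) * ∫⁻ w in ball 0 ρ, f w ∂μ := by
  have hball (u : Circle) (w : E) : u • w ∈ ball 0 ρ ↔ w ∈ ball 0 ρ := by
    simp [Circle.smul_def, norm_smul, Circle.norm_coe]
  calc ∫⁻ w in ball 0 ρ, (∫⁻ θ in Ioc 0 (2 * π), f (Circle.exp θ • w)) ∂μ
    _ = ∫⁻ w, (∫⁻ θ in Ioc 0 (2 * π), (ball 0 ρ).indicator f (Circle.exp θ • w)) ∂μ := by
        rw [← lintegral_indicator measurableSet_ball]
        refine lintegral_congr fun w => ?_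
        by_cases hw : w ∈ ball 0 ρ <;> simp only [indicator, hball, hw, if_true, if_false,
          lintegral_zero]
    _ = ∫⁻ θ in Ioc 0 (2 * π), (∫⁻ w, (ball 0 ρ).indicator f (Circle.exp θ • w) ∂μ) :=
        lintegral_lintegral_swap <| Measurable.aemeasurable <| hf.comp <| Continuous.measurable <|
          (Circle.exp.continuous.comp continuous_snd).smul continuous_fst
    _ = ∫⁻ _ in Ioc 0 (2 * π), (∫⁻ w in ball 0 ρ, f w ∂μ) := by
        refine lintegral_congr fun θ => ?_
        rw [(measurePreserving_smul (Circle.exp θ) μ).lintegral_comp hf,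
          lintegral_indicator measurableSet_ball]
    _ = ENNReal.ofReal (2 * π) * ∫⁻ w in ball 0 ρ, f w ∂μ := by
        rw [setLIntegral_const, Real.volume_Ioc, sub_zero, mul_comm]

theorem ofReal_log_norm_mul_measure_ball_le [SecondCountableTopology E] (μ : Measure E)
    [SFinite μ] [SMulInvariantMeasure Circle E μ] {G : E → ℂ} {x : E} {ρ : ℝ}
    (hG : DifferentiableOn ℂ G (ball x ρ)) :
    ENNReal.ofReal (Real.log ‖G x‖) * μ (ball 0 ρ) ≤
      ∫⁻ w in ball 0 ρ, ENNReal.ofReal (log⁺ ‖G (x + w)‖) ∂μ := by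
  have hmeas : Measurable
      ((ball 0 ρ).indicator fun w => ENNReal.ofReal (log⁺ ‖G (x + w)‖)) := by
    have hcont : ContinuousOn (fun w => G (x + w)) (ball 0 ρ) :=
      hG.continuousOn.comp (by fun_prop) fun w hw => by simpa using hw
    classical
    rw [← piecewise_eq_indicator]
    exact ((ENNReal.continuous_ofReal.comp continuous_posLog).comp_continuousOn
      hcont.norm).measurable_piecewise continuousOn_const measurableSet_ball
  have circle_le : ∀ w ∈ ball (0 : E) ρ,
      ENNReal.ofReal (Real.log ‖G x‖) * ENNReal.ofReal (2 * π) ≤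
        ∫⁻ θ in Ioc 0 (2 * π), ENNReal.ofReal (log⁺ ‖G (x + Circle.exp θ • w)‖) := by
    intro w hw
    have hline : AnalyticOnNhd ℂ (fun z : ℂ => G (x + z • w)) (closedBall 0 1) := by
      have hopen : IsOpen ((fun z : ℂ => x + z • w) ⁻¹' ball x ρ) :=
        isOpen_ball.preimage (by fun_prop)
      refine ((hG.comp (f := fun z : ℂ => x + z • w) (by fun_prop)
        (mapsTo_preimage _ _)).analyticOnNhd hopen).mono fun z hz => ?_
      rw [mem_closedBall_zero_iff] at hz
      rw [mem_ball_zero_iff] at hw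
      rw [mem_preimage, mem_ball, dist_self_add_left, norm_smul]
      exact (mul_le_of_le_one_left (norm_nonneg w) hz).trans_lt hw
    simpa [Circle.smul_def] using ofReal_log_norm_mul_le_lintegral hline
  have two_pi_pos' : ENNReal.ofReal (2 * π) ≠ 0 := by simp [pi_pos]
  rw [← ENNReal.mul_le_mul_iff_right two_pi_pos' ENNReal.ofReal_ne_top,
    ← lintegral_ball_circleAverage μ hmeas, ← mul_assoc, mul_comm (ENNReal.ofReal (2 * π)),
    ← setLIntegral_const]
  exact setLIntegral_mono' measurableSet_ball circle_le

theorem setLIntegral_ofReal_posLog_le {α : Type*} [MeasurableSpace α] (μ : Measure α) {s : Set α}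
    (hs : MeasurableSet s) {f : α → ℝ} {B : ℝ} (hf : ∀ w ∈ s, 0 ≤ f w) (hfB : ∀ w ∈ s, f w ≤ B) :
    ∫⁻ w in s, ENNReal.ofReal (log⁺ (f w)) ∂μ ≤
      ENNReal.ofReal (Real.log B) * μ {w ∈ s | 1 < f w} := by
  have posLog_le : ∀ w ∈ s, ENNReal.ofReal (log⁺ (f w)) ≤
      {w ∈ s | 1 < f w}.indicator (fun _ => ENNReal.ofReal (Real.log B)) w := by
    intro w hw
    by_cases h : 1 < f w
    · rw [indicator_of_mem (show w ∈ {w ∈ s | 1 < f w} from ⟨hw, h⟩),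
        posLog_eq_log (h.le.trans (le_abs_self _))]
      gcongr
      exact hfB w hw
    · rw [(posLog_eq_zero_iff _).2 (by rw [abs_of_nonneg (hf w hw)]; exact not_lt.1 h),
        ENNReal.ofReal_zero]
      exact zero_le
  calc ∫⁻ w in s, ENNReal.ofReal (log⁺ (f w)) ∂μ
    _ ≤ ENNReal.ofReal (Real.log B) * μ.restrict s {w ∈ s | 1 < f w} :=
        (setLIntegral_mono' hs posLog_le).trans (lintegral_indicator_const_le _ _)
    _ ≤ ENNReal.ofReal (Real.log B) * μ {w ∈ s | 1 < f w} := by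
        gcongr
        exact Measure.restrict_le_self

theorem norm_sq_le_mul_of_measure_le [FiniteDimensional ℂ E] (μ : Measure E) [μ.IsAddHaarMeasure]
    [SMulInvariantMeasure Circle E μ] {G : E → ℂ} {x : E} {ρ A B : ℝ} (hρ : 0 < ρ)
    (hA : 0 < A) (hAB : A ≤ B) (hG : DifferentiableOn ℂ G (ball x ρ))
    (hGB : ∀ w ∈ ball 0 ρ, ‖G (x + w)‖ ≤ B)
    (hμ : 2 * μ {w ∈ ball 0 ρ | A < ‖G (x + w)‖} ≤ μ (ball 0 ρ)) :
    ‖G x‖ ^ 2 ≤ A * B := by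
  have : ProperSpace E := FiniteDimensional.proper ℂ E
  rcases eq_or_ne (G x) 0 with h0 | h0
  · simpa [h0] using (mul_pos hA (hA.trans_le hAB)).le
  have norm_inv_A_mul (w : E) : ‖(A : ℂ)⁻¹ * G w‖ = ‖G w‖ / A := by
    rw [norm_mul, norm_inv, Complex.norm_real, Real.norm_of_nonneg hA.le, inv_mul_eq_div]
  have log_le : 2 * ENNReal.ofReal (Real.log (‖G x‖ / A)) ≤ ENNReal.ofReal (Real.log (B / A)) := by
    have mean_value := ofReal_log_norm_mul_measure_ball_le μ
      (G := fun w => (A : ℂ)⁻¹ * G w) (hG.const_mul _)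
    have excess := setLIntegral_ofReal_posLog_le (B := B / A) μ (measurableSet_ball (ε := ρ))
      (f := fun w => ‖G (x + w)‖ / A) (fun w _ => by positivity)
      (fun w hw => by gcongr; exact hGB w hw)
    simp only [norm_inv_A_mul, one_lt_div hA] at mean_value excess
    rw [← ENNReal.mul_le_mul_iff_left (measure_ball_pos μ (0 : E) hρ).ne' measure_ball_lt_top.ne]
    calc 2 * ENNReal.ofReal (Real.log (‖G x‖ / A)) * μ (ball 0 ρ)
      _ ≤ 2 * (ENNReal.ofReal (Real.log (B / A)) * μ {w ∈ ball 0 ρ | A < ‖G (x + w)‖}) := by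
          rw [mul_assoc]
          gcongr 2 * ?_
          exact mean_value.trans excess
      _ ≤ ENNReal.ofReal (Real.log (B / A)) * μ (ball 0 ρ) := by
          rw [mul_left_comm]
          gcongr
  rw [← ENNReal.ofReal_ofNat, ← ENNReal.ofReal_mul zero_le_two,
    ENNReal.ofReal_le_ofReal_iff (Real.log_nonneg ((one_le_div hA).2 hAB)), ← Nat.cast_two,
    ← Real.log_pow, Real.log_le_log_iff (by positivity) (div_pos (hA.trans_le hAB) hA), div_pow,
    div_le_iff₀ (by positivity)] at log_le
  calc ‖G x‖ ^ 2 ≤ B / A * A ^ 2 := log_le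
    _ = A * B := by field_simp

end SubmeanValue

section WeakHolomorphy

open Metric Set Filter Topology

variable {E W : Type*} [NormedAddCommGroup E] [NormedSpace ℂ E] [NormedAddCommGroup W]
  [NormedSpace ℂ W] {a : E} {ρ C : ℝ}

theorem norm_fderiv_le_of_norm_le {f : E → W} (hρ : 0 < ρ) (hf : DifferentiableOn ℂ f (ball a ρ))
    (hC : ∀ x ∈ ball a ρ, ‖f x‖ ≤ C) : ‖fderiv ℂ f a‖ ≤ 2 * C / ρ := by
  refine Complex.norm_fderiv_le_div_of_mapsTo_ball hf (fun x hx => ?_) hρ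
  rw [mem_closedBall, dist_eq_norm, two_mul]
  exact norm_sub_le_of_le (hC x hx) (hC a (mem_ball_self hρ))

theorem norm_sub_sub_fderiv_le_of_norm_le {f : E → W} (hf : DifferentiableOn ℂ f (ball a ρ))
    (hC : ∀ x ∈ ball a ρ, ‖f x‖ ≤ C) {x : E} (hx : x ∈ ball a ρ) :
    ‖f x - f a - fderiv ℂ f a (x - a)‖ ≤ 4 * C * (dist x a / ρ) ^ 2 := by
  have hρ : 0 < ρ := pos_of_mem_ball hx
  let g : E → W := fun y => f y - f a - fderiv ℂ f a (y - a)
  have hga : g a = 0 := by simp [g]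
  have hmaps : MapsTo g (ball a ρ) (closedBall (g a) (4 * C)) := by
    intro y hy
    rw [mem_closedBall, hga, dist_zero_right]
    have hlin : ‖fderiv ℂ f a (y - a)‖ ≤ 2 * C / ρ * ρ :=
      (fderiv ℂ f a).le_of_opNorm_le_of_le (norm_fderiv_le_of_norm_le hρ hf hC)
        (mem_ball_iff_norm.1 hy).le
    rw [div_mul_cancel₀ _ hρ.ne'] at hlin
    linarith [norm_sub_le (f y - f a) (fderiv ℂ f a (y - a)), norm_sub_le (f y) (f a), hC y hy,
      hC a (mem_ball_self hρ)]
  have hlittle : (g · - g a) =o[𝓝 a] fun w => ‖w - a‖ ^ 1 := by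
    simpa only [hga, sub_zero, pow_one] using
      (hf.differentiableAt (ball_mem_nhds a hρ)).hasFDerivAt.isLittleO.norm_right
  have := Complex.dist_le_mul_div_pow_of_mapsTo_ball_of_isLittleO (f := g)
    ((hf.sub_const _).sub (by fun_prop)) hmaps hlittle hx
  rwa [hga, dist_zero_right] at this

theorem differentiableAt_of_norm_sub_sub_le {f : E → W} {D : E →L[ℂ] W} (hρ : 0 < ρ)
    (hf : ∀ x ∈ ball a ρ, ‖f x - f a - D (x - a)‖ ≤ C * dist x a ^ 2) :
    DifferentiableAt ℂ f a := by
  refine HasFDerivAt.differentiableAt (f' := D) (.of_isLittleO ?_)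
  refine Asymptotics.IsBigO.trans_isLittleO (.of_bound C ?_)
    (Asymptotics.isLittleO_pow_sub_sub a one_lt_two)
  filter_upwards [ball_mem_nhds a hρ] with x hx
  simpa [dist_eq_norm] using hf x hx

variable {V : Type*} [NormedAddCommGroup V] [NormedSpace ℂ V] {κ : E → V →L[ℂ] W}
  {S : Submodule ℂ V}

theorem exists_flip_apply_eq_fderiv [CompleteSpace W] (hρ : 0 < ρ) (hS : Dense (S : Set V))
    (hκ : ∀ f ∈ S, DifferentiableOn ℂ (fun x => κ x f) (ball a ρ))
    (hC : ∀ x ∈ ball a ρ, ‖κ x‖ ≤ C) :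
    ∃ D : E →L[ℂ] V →L[ℂ] W, ∀ f ∈ S, D.flip f = fderiv ℂ (fun x => κ x f) a := by
  have hκa (f : S) : DifferentiableAt ℂ (fun x => κ x f) a :=
    (hκ f f.2).differentiableAt (ball_mem_nhds a hρ)
  let A : S →ₗ[ℂ] E →L[ℂ] W :=
    { toFun := fun f => fderiv ℂ (fun x => κ x f) a
      map_add' := fun f g => by
        simpa only [Submodule.coe_add, map_add] using fderiv_fun_add (hκa f) (hκa g)
      map_smul' := fun c f => by
        simpa only [Submodule.coe_smul, map_smul, RingHom.id_apply] using
          fderiv_fun_const_smul (hκa f) c }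
  have hA (f : S) : ‖A f‖ ≤ 2 * C / ρ * ‖S.subtype f‖ := by
    calc ‖A f‖ ≤ 2 * (C * ‖(f : V)‖) / ρ :=
          norm_fderiv_le_of_norm_le hρ (hκ f f.2) fun x hx => (κ x).le_of_opNorm_le (hC x hx) _
      _ = 2 * C / ρ * ‖S.subtype f‖ := by rw [S.subtype_apply]; ring
  refine ⟨(A.extendOfNorm S.subtype).flip, fun f hf => ?_⟩
  exact LinearMap.extendOfNorm_eq (by simpa [DenseRange] using hS) ⟨_, hA⟩ ⟨f, hf⟩

theorem differentiableAt_of_dense [CompleteSpace W] (hρ : 0 < ρ) (hS : Dense (S : Set V))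
    (hκ : ∀ f ∈ S, DifferentiableOn ℂ (fun x => κ x f) (ball a ρ))
    (hC : ∀ x ∈ ball a ρ, ‖κ x‖ ≤ C) : DifferentiableAt ℂ κ a := by
  obtain ⟨D, hD⟩ := exists_flip_apply_eq_fderiv hρ hS hκ hC
  have hC0 : 0 ≤ C := (norm_nonneg _).trans (hC a (mem_ball_self hρ))
  refine differentiableAt_of_norm_sub_sub_le (D := D) (C := 4 * C / ρ ^ 2) hρ fun x hx => ?_
  refine ContinuousLinearMap.opNorm_le_bound _ (by positivity) fun f => ?_
  refine hS.induction
    (P := fun f => ‖(κ x - κ a - D (x - a)) f‖ ≤ 4 * C / ρ ^ 2 * dist x a ^ 2 * ‖f‖)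
    (fun f hf => ?_) (isClosed_le (by fun_prop) (by fun_prop)) f
  calc ‖(κ x - κ a - D (x - a)) f‖ = ‖κ x f - κ a f - fderiv ℂ (fun y => κ y f) a (x - a)‖ := by
        rw [← hD f hf]
        rfl
    _ ≤ 4 * (C * ‖f‖) * (dist x a / ρ) ^ 2 :=
        norm_sub_sub_fderiv_le_of_norm_le (hκ f hf)
          (fun y hy => (κ y).le_of_opNorm_le (hC y hy) f) hx
    _ = 4 * C / ρ ^ 2 * dist x a ^ 2 * ‖f‖ := by ring

end WeakHolomorphy

section UniformBoundedness

open MeasureTheory Set Filter Topology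

variable {Y : Type*} {S : Set Y}

theorem exists_nat_forall_le {f : Y → ℝ} (hf : BddAbove (f '' S)) :
    ∃ M : ℕ, ∀ y ∈ S, f y ≤ M := by
  obtain ⟨C, hC⟩ := hf
  obtain ⟨M, hM⟩ := exists_nat_ge C
  exact ⟨M, fun y hy => (hC (mem_image_of_mem f hy)).trans hM⟩

variable {E : Type*} [TopologicalSpace E] {g : Y → E → ℝ} {U : Set E}

theorem isOpen_setOf_exists_lt (hU : IsOpen U) (hg : ∀ y ∈ S, ContinuousOn (g y) U) (M : ℝ) :
    IsOpen {x ∈ U | ∃ y ∈ S, M < g y x} := by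
  have : {x ∈ U | ∃ y ∈ S, M < g y x} = ⋃ y ∈ S, U ∩ g y ⁻¹' Ioi M := by
    ext x
    simp
  rw [this]
  exact isOpen_biUnion fun y hy => (hg y hy).isOpen_inter_preimage hU isOpen_Ioi

theorem tendsto_measure_setOf_exists_lt [MeasurableSpace E] [OpensMeasurableSpace E]
    {μ : Measure E} (hU : IsOpen U) (hg : ∀ y ∈ S, ContinuousOn (g y) U)
    (hb : ∀ x ∈ U, BddAbove ((g · x) '' S)) (hμ : μ U ≠ ⊤) :
    Tendsto (fun M : ℕ => μ {x ∈ U | ∃ y ∈ S, M < g y x}) atTop (𝓝 0) := by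
  have anti : Antitone fun M : ℕ => {x ∈ U | ∃ y ∈ S, M < g y x} :=
    fun M M' hM x ⟨hx, y, hy, hlt⟩ => ⟨hx, y, hy, (Nat.cast_le.2 hM).trans_lt hlt⟩
  have empty : ⋂ M : ℕ, {x ∈ U | ∃ y ∈ S, M < g y x} = ∅ := by
    refine eq_empty_iff_forall_notMem.2 fun x hx => ?_
    rw [mem_iInter] at hx
    obtain ⟨M, hM⟩ := exists_nat_forall_le (hb x (hx 0).1)
    obtain ⟨_, y, hy, hlt⟩ := hx M
    exact hlt.not_ge (hM y hy)
  simpa only [empty, measure_empty, Function.comp_def] using tendsto_measure_iInter_atTop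
    (fun M : ℕ => (isOpen_setOf_exists_lt hU hg M).measurableSet.nullMeasurableSet) anti
    ⟨0, measure_ne_top_of_subset (sep_subset _ _) hμ⟩

theorem exists_eventually_forall_le [BaireSpace E] (hU : IsOpen U) (hne : U.Nonempty)
    (hg : ∀ y ∈ S, ContinuousOn (g y) U) (hb : ∀ x ∈ U, BddAbove ((g · x) '' S)) :
    ∃ b ∈ U, ∃ M : ℕ, ∀ᶠ x in 𝓝 b, ∀ y ∈ S, g y x ≤ M := by
  have closed (M : ℕ) : IsClosed {x ∈ U | ∃ y ∈ S, M < g y x}ᶜ :=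
    (isOpen_setOf_exists_lt hU hg M).isClosed_compl
  have cover : ⋃ M : ℕ, {x ∈ U | ∃ y ∈ S, M < g y x}ᶜ = univ := by
    refine eq_univ_of_forall fun x => mem_iUnion.2 ?_
    by_cases hx : x ∈ U
    · obtain ⟨M, hM⟩ := exists_nat_forall_le (hb x hx)
      exact ⟨M, fun ⟨_, y, hy, hlt⟩ => hlt.not_ge (hM y hy)⟩
    · exact ⟨0, fun h => hx h.1⟩
  obtain ⟨b, hbU, hb⟩ := (dense_iUnion_interior_of_closed closed cover).inter_open_nonempty U hU hne
  obtain ⟨M, hM⟩ := mem_iUnion.1 hb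
  refine ⟨b, hbU, M, ?_⟩
  filter_upwards [isOpen_interior.mem_nhds hM, hU.mem_nhds hbU] with x hx hxU y hy
  exact not_lt.1 fun hlt => interior_subset hx ⟨hxU, y, hy, hlt⟩

end UniformBoundedness

section Taylor

open Metric

variable {V W : Type*} [NormedAddCommGroup V] [NormedSpace ℂ V] [NormedAddCommGroup W]
  [NormedSpace ℂ W]

/-- The coefficient of `z ^ m` in the Taylor expansion of `ψ` at `0`. -/
noncomputable def taylorCoeff (ψ : ℂ → V) (m : ℕ) : V :=
  (m.factorial : ℂ)⁻¹ • iteratedDeriv m ψ 0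

variable [CompleteSpace V]

theorem map_taylorCoeff {ψ : ℂ → V} (hψ : AnalyticAt ℂ ψ 0) (T : V →L[ℂ] W) (m : ℕ) :
    T (taylorCoeff ψ m) = taylorCoeff (fun z => T (ψ z)) m := by
  have h := T.iteratedFDeriv_comp_left (n := m) hψ.contDiffAt le_rfl
  simp only [taylorCoeff, map_smul, iteratedDeriv_eq_iteratedFDeriv]
  change _ = _ • iteratedFDeriv ℂ m (T ∘ ψ) 0 fun _ => 1
  rw [h]
  rfl

theorem norm_taylorCoeff_le {ψ : ℂ → V} {R B : ℝ} (hR : 0 < R)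
    (hψ : DiffContOnCl ℂ ψ (ball 0 R)) (hB : ∀ z ∈ sphere 0 R, ‖ψ z‖ ≤ B) (m : ℕ) :
    ‖taylorCoeff ψ m‖ ≤ B / R ^ m := by
  rw [taylorCoeff, norm_smul, norm_inv, Complex.norm_natCast, inv_mul_le_iff₀ (by positivity),
    ← mul_div_assoc]
  exact Complex.norm_iteratedDeriv_le_of_forall_mem_sphere_norm_le m hR hψ hB

theorem hasSum_taylorCoeff {ψ : ℂ → V} {R : ℝ} (hψ : DifferentiableOn ℂ ψ (ball 0 R)) {z : ℂ}
    (hz : z ∈ ball 0 R) : HasSum (fun m => z ^ m • taylorCoeff ψ m) (ψ z) := by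
  refine (Complex.hasSum_taylorSeries_on_ball hψ hz).congr_fun fun m => ?_
  rw [taylorCoeff, sub_zero, smul_comm]

variable {F : Type*} [NormedAddCommGroup F] [InnerProductSpace ℂ F] [CompleteSpace F]

theorem dualInner_taylorCoeff {ψ : ℂ → StrongDual ℂ F} (hψ : AnalyticAt ℂ ψ 0)
    (h : StrongDual ℂ F) (m : ℕ) :
    dualInner (taylorCoeff ψ m) h = taylorCoeff (fun z => dualInner (ψ z) h) m := by
  simp only [dualInner_eq_apply]
  exact map_taylorCoeff hψ (ContinuousLinearMap.apply ℂ ℂ _) m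

theorem norm_taylorCoeff_sq_le {ψ : ℂ → StrongDual ℂ F} {R B : ℝ} (hR : 0 < R)
    (hψ : DifferentiableOn ℂ ψ (closedBall 0 R)) {m : ℕ}
    (hB : ∀ z ∈ sphere 0 R, ‖dualInner (ψ z) (taylorCoeff ψ m)‖ ≤ B) :
    ‖taylorCoeff ψ m‖ ^ 2 ≤ B / R ^ m := by
  rw [← norm_dualInner_self, dualInner_taylorCoeff (hψ.analyticAt (closedBall_mem_nhds _ hR))]
  exact norm_taylorCoeff_le hR ((differentiableOn_dualInner hψ _).diffContOnCl_ball subset_rfl) hB m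

end Taylor

section Hartogs

open MeasureTheory Metric Set Filter Topology InnerProductSpace

variable {E : Type*} [NormedAddCommGroup E] [NormedSpace ℂ E]
  {F : Type*} [NormedAddCommGroup F] [InnerProductSpace ℂ F] [CompleteSpace F]
  {κ : E → StrongDual ℂ F} {X : Set E}

/-- The Gram kernel `⟨κ x, κ y⟩` is holomorphic in `x ∈ X` for each fixed `y ∈ X`, hence
antiholomorphic in `y`. No joint regularity is assumed. -/
def HasHolomorphicGram (κ : E → StrongDual ℂ F) (X : Set E) : Prop :=
  ∀ y ∈ X, DifferentiableOn ℂ (fun x => dualInner (κ x) (κ y)) X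

/-- The space of vectors `f` for which `x ↦ κ x f` is holomorphic on `X`; weak holomorphy of `κ`
is tested on it. -/
def holomorphicTestSpace (κ : E → StrongDual ℂ F) (X : Set E) : Submodule ℂ F where
  carrier := {f | DifferentiableOn ℂ (fun x => κ x f) X}
  zero_mem' := by simp
  add_mem' hf hg := by simpa using DifferentiableOn.fun_add hf hg
  smul_mem' c f hf := by simpa using DifferentiableOn.fun_const_smul (c := c) hf

namespace HasHolomorphicGram

theorem dense_holomorphicTestSpace (hκ : HasHolomorphicGram κ X) :
    Dense (holomorphicTestSpace κ X : Set F) := by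
  rw [Submodule.dense_iff_topologicalClosure_eq_top, Submodule.topologicalClosure_eq_top_iff,
    Submodule.eq_bot_iff]
  intro f hf
  have apply_eq_zero {y : E} (hy : y ∈ X) : κ y f = 0 := by
    rw [← toDual_symm_apply]
    refine (Submodule.mem_orthogonal _ _).1 hf _ ?_
    simpa only [dualInner_eq_apply] using! hκ y hy
  have hfS : f ∈ holomorphicTestSpace κ X :=
    (differentiableOn_const (0 : ℂ)).congr fun y hy => apply_eq_zero hy
  exact inner_self_eq_zero.1 ((Submodule.mem_orthogonal _ _).1 hf f hfS)

theorem differentiableAt_of_norm_le (hκ : HasHolomorphicGram κ X) {a : E} {ρ C : ℝ} (hρ : 0 < ρ)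
    (hX : ball a ρ ⊆ X) (hC : ∀ x ∈ ball a ρ, ‖κ x‖ ≤ C) : DifferentiableAt ℂ κ a :=
  differentiableAt_of_dense hρ hκ.dense_holomorphicTestSpace (fun _ hf => hf.mono hX) hC

theorem differentiableOn_ball_of_norm_le (hκ : HasHolomorphicGram κ X) {b : E} {t C : ℝ}
    (hX : ball b t ⊆ X) (hC : ∀ x ∈ ball b t, ‖κ x‖ ≤ C) : DifferentiableOn ℂ κ (ball b t) := by
  intro x hx
  obtain ⟨ρ, hρ, hsub⟩ := isOpen_iff.1 isOpen_ball x hx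
  exact (hκ.differentiableAt_of_norm_le hρ (hsub.trans hX)
    fun y hy => hC y (hsub hy)).differentiableWithinAt

theorem continuousOn_norm_dualInner (hκ : HasHolomorphicGram κ X) {y : E} (hy : y ∈ X) :
    ContinuousOn (fun x => ‖dualInner (κ y) (κ x)‖) X := by
  simpa only [norm_dualInner_symm (κ y)] using (hκ y hy).continuousOn.norm

theorem bddAbove_norm_dualInner (hκ : HasHolomorphicGram κ X) {S : Set E} (hS : IsCompact S)
    (hSX : S ⊆ X) {x : E} (hx : x ∈ X) :
    BddAbove ((fun y => ‖dualInner (κ y) (κ x)‖) '' S) :=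
  hS.bddAbove_image ((hκ x hx).continuousOn.norm.mono hSX)

end HasHolomorphicGram

theorem norm_le_of_dense_hasSum {V W : Type*} [NormedAddCommGroup V] [NormedSpace ℂ V]
    [NormedAddCommGroup W] [NormedSpace ℂ W] {φ : ℕ → V →L[ℂ] W} {T : V →L[ℂ] W} {u : ℕ → ℝ}
    {A : ℝ} {S : Set V} (hu : HasSum u A) (hφ : ∀ m, ‖φ m‖ ≤ u m) (hS : Dense S)
    (h : ∀ f ∈ S, HasSum (fun m => φ m f) (T f)) : ‖T‖ ≤ A := by
  refine T.opNorm_le_bound (hu.nonneg fun m => (norm_nonneg _).trans (hφ m)) fun f => ?_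
  refine hS.induction (P := fun f => ‖T f‖ ≤ A * ‖f‖) (fun f hf => ?_)
    (isClosed_le (by fun_prop) (by fun_prop)) f
  exact (h f hf).norm_le_of_bounded (hu.mul_right ‖f‖) fun m => (φ m).le_of_opNorm_le (hφ m) f

theorem add_smul_mem_closedBall {b v : E} {z : ℂ} {r : ℝ} (hv : ‖v‖ ≤ 1) (hz : ‖z‖ ≤ r) :
    b + z • v ∈ closedBall b r := by
  rw [mem_closedBall, dist_eq_norm, add_sub_cancel_left, norm_smul]
  exact (mul_le_of_le_one_right (norm_nonneg z) hv).trans hz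

theorem exists_eq_add_smul {b x : E} {r : ℝ} (hx : x ∈ closedBall b r) :
    ∃ v : E, ‖v‖ ≤ 1 ∧ ∃ z : ℂ, ‖z‖ ≤ r ∧ x = b + z • v := by
  rw [mem_closedBall, dist_eq_norm] at hx
  refine ⟨(‖x - b‖ : ℂ)⁻¹ • (x - b), ?_, ‖x - b‖, by simpa using hx, ?_⟩
  · rw [norm_smul, norm_inv, Complex.norm_real, norm_norm]
    exact inv_mul_le_one
  · rcases eq_or_ne x b with rfl | h
    · simp
    · rw [smul_inv_smul₀ (by simpa [sub_eq_zero] using h), add_sub_cancel]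

theorem exists_isAddHaarMeasure_smulInvariantMeasure_circle (E : Type*) [NormedAddCommGroup E]
    [NormedSpace ℂ E] [FiniteDimensional ℂ E] [MeasurableSpace E] [BorelSpace E] :
    ∃ μ : Measure E, μ.IsAddHaarMeasure ∧ SMulInvariantMeasure Circle E μ := by
  have : IsIsometricSMul Circle E := ⟨fun u => Isometry.of_dist_eq fun x y => by
    rw [dist_eq_norm, dist_eq_norm, ← smul_sub, Circle.norm_smul]⟩
  exact ⟨μH[Module.finrank ℝ E], inferInstance, inferInstance⟩

theorem norm_sq_le_mul_of_measure_exceptional_le [FiniteDimensional ℂ E] [MeasurableSpace E]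
    [BorelSpace E] (μ : Measure E) [μ.IsAddHaarMeasure] [SMulInvariantMeasure Circle E μ]
    {g : E → ℂ} {N : Set E} {b : E} {s A B : ℝ} (hs : 0 < s) (hA : 0 < A) (hAB : A ≤ B)
    (hg : DifferentiableOn ℂ g (ball b s)) (hB : ∀ x ∈ ball b s, ‖g x‖ ≤ B)
    (hgA : ∀ x ∈ ball b s \ N, ‖g x‖ ≤ A) (hN : 2 * μ N ≤ μ (ball 0 (s / 2))) {x : E}
    (hx : x ∈ closedBall b (s / 2)) : ‖g x‖ ^ 2 ≤ A * B := by
  have hsub : ball x (s / 2) ⊆ ball b s :=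
    ball_subset_ball' (by linarith [mem_closedBall.1 hx])
  have add_mem {w : E} (hw : w ∈ ball (0 : E) (s / 2)) : x + w ∈ ball b s :=
    hsub (by simpa using hw)
  refine norm_sq_le_mul_of_measure_le μ (half_pos hs) hA hAB (hg.mono hsub)
    (fun w hw => hB _ (add_mem hw)) (le_trans ?_ hN)
  rw [← measure_preimage_add μ x N]
  gcongr
  rintro w ⟨hw, hlt⟩
  by_contra hwN
  exact hlt.not_ge (hgA _ ⟨add_mem hw, hwN⟩)

theorem analyticAt_line {W : Type*} [NormedAddCommGroup W] [NormedSpace ℂ W] [CompleteSpace W]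
    {f : E → W} {b : E} (hf : ∀ᶠ x in 𝓝 b, DifferentiableAt ℂ f x) (v : E) :
    AnalyticAt ℂ (fun z : ℂ => f (b + z • v)) 0 := by
  rw [Complex.analyticAt_iff_eventually_differentiableAt]
  have hline : Continuous fun z : ℂ => b + z • v := by fun_prop
  filter_upwards [hline.tendsto' 0 b (by simp) hf] with z hz
  exact DifferentiableAt.comp z hz (by fun_prop)

theorem HasHolomorphicGram.differentiableOn_line (hκ : HasHolomorphicGram κ X) {b v : E}
    (hv : ‖v‖ ≤ 1) {R : ℝ} (hX : closedBall b R ⊆ X) {x : E} (hx : x ∈ X) :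
    DifferentiableOn ℂ (fun z : ℂ => dualInner (κ (b + z • v)) (κ x)) (closedBall 0 R) :=
  (hκ x hx).comp (by fun_prop) fun _ hz =>
    hX (add_smul_mem_closedBall hv (mem_closedBall_zero_iff.1 hz))

theorem HasHolomorphicGram.norm_dualInner_taylorCoeff_le (hκ : HasHolomorphicGram κ X) {b v : E}
    (hv : ‖v‖ ≤ 1) {R Q : ℝ} (hR : 0 < R) (hX : closedBall b R ⊆ X)
    (hψ : AnalyticAt ℂ (fun z : ℂ => κ (b + z • v)) 0) {x : E} (hx : x ∈ X)
    (hQ : ∀ y ∈ closedBall b R, ‖dualInner (κ y) (κ x)‖ ≤ Q) (m : ℕ) :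
    ‖dualInner (κ x) (taylorCoeff (fun z : ℂ => κ (b + z • v)) m)‖ ≤ Q / R ^ m := by
  rw [norm_dualInner_symm, dualInner_taylorCoeff hψ]
  exact norm_taylorCoeff_le hR
    ((hκ.differentiableOn_line hv hX hx).diffContOnCl_ball subset_rfl)
    (fun z hz => hQ _ (add_smul_mem_closedBall hv (mem_sphere_zero_iff_norm.1 hz).le)) m

theorem HasHolomorphicGram.norm_le_of_norm_taylorCoeff_le (hκ : HasHolomorphicGram κ X) {b : E}
    {R R₀ Q : ℝ} (hRX : ball b R ⊆ X) (hκd : ∀ᶠ x in 𝓝 b, DifferentiableAt ℂ κ x)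
    (hQ : ∀ v : E, ‖v‖ ≤ 1 → ∀ m, ‖taylorCoeff (fun z : ℂ => κ (b + z • v)) m‖ ≤ Q / R₀ ^ m)
    {r : ℝ} (hrR : r < R) (hrR₀ : r < R₀) {x : E} (hx : x ∈ closedBall b r) :
    ‖κ x‖ ≤ Q * (1 - r / R₀)⁻¹ := by
  obtain ⟨v, hv, z, hz, rfl⟩ := exists_eq_add_smul hx
  have hr : 0 ≤ r := (norm_nonneg z).trans hz
  have norm_term_le (m : ℕ) :
      ‖z ^ m • taylorCoeff (fun z : ℂ => κ (b + z • v)) m‖ ≤ Q * (r / R₀) ^ m :=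
    calc ‖z ^ m • taylorCoeff (fun z : ℂ => κ (b + z • v)) m‖
      _ ≤ r ^ m * (Q / R₀ ^ m) := by
          rw [norm_smul, norm_pow]
          gcongr
          exact hQ v hv m
      _ = Q * (r / R₀) ^ m := by ring
  refine norm_le_of_dense_hasSum ((hasSum_geometric_of_lt_one (div_nonneg hr (by linarith))
    ((div_lt_one (by linarith)).2 hrR₀)).mul_left Q) norm_term_le hκ.dense_holomorphicTestSpace
    fun f hf => ?_
  have hline : DifferentiableOn ℂ (fun z : ℂ => κ (b + z • v) f) (ball 0 R) := by
    refine hf.comp (by fun_prop) fun w hw => hRX ?_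
    exact closedBall_subset_ball (mem_ball_zero_iff.1 hw) (add_smul_mem_closedBall hv le_rfl)
  convert hasSum_taylorCoeff hline (mem_ball_zero_iff.2 (hz.trans_lt hrR)) using 2 with m
  exact congrArg (z ^ m • ·)
    (map_taylorCoeff (analyticAt_line hκd v) (ContinuousLinearMap.apply ℂ ℂ f) m)

variable {W : Type*} [NormedAddCommGroup W] [NormedSpace ℂ W] {f : E → W} {b : E} {s t Q : ℝ}

theorem differentiableOn_line_of_lt (hst : s < t) (hf : DifferentiableOn ℂ f (ball b t)) {v : E}
    (hv : ‖v‖ ≤ 1) :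
    DifferentiableOn ℂ (fun z : ℂ => f (b + z • v)) (closedBall 0 s) :=
  hf.comp (by fun_prop) fun _ hz => closedBall_subset_ball hst
    (add_smul_mem_closedBall hv (mem_closedBall_zero_iff.1 hz))

theorem norm_taylorCoeff_line_le [CompleteSpace W] (hs : 0 < s) (hst : s < t)
    (hf : DifferentiableOn ℂ f (ball b t)) (hfQ : ∀ x ∈ ball b t, ‖f x‖ ≤ Q) {v : E}
    (hv : ‖v‖ ≤ 1) (m : ℕ) : ‖taylorCoeff (fun z : ℂ => f (b + z • v)) m‖ ≤ Q / s ^ m :=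
  norm_taylorCoeff_le hs
    ((differentiableOn_line_of_lt hst hf hv).diffContOnCl_ball subset_rfl)
    (fun _ hz => hfQ _ (closedBall_subset_ball hst
      (add_smul_mem_closedBall hv (mem_sphere_zero_iff_norm.1 hz).le))) m

/- The coefficient `c` paired with itself is the `m`-th coefficient of `z ↦ ⟨κ (b + z • v), c⟩`,
so a bound for the latter bounds `‖c‖ ^ 2`. -/
theorem norm_taylorCoeff_line_le_of_dualInner (hs : 0 < s) (hst : s < t)
    (hκd : DifferentiableOn ℂ κ (ball b t)) (hQ : 0 ≤ Q) {v : E} (hv : ‖v‖ ≤ 1) {m : ℕ}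
    (hc : ∀ x ∈ closedBall b (s / 2),
      ‖dualInner (κ x) (taylorCoeff (fun z : ℂ => κ (b + z • v)) m)‖ ≤ Q ^ 2 / (8 * s) ^ m) :
    ‖taylorCoeff (fun z : ℂ => κ (b + z • v)) m‖ ≤ Q / (2 * s) ^ m := by
  have norm_sq_le := norm_taylorCoeff_sq_le (half_pos hs)
    (differentiableOn_line_of_lt (by linarith) hκd hv) fun z hz =>
      hc _ (add_smul_mem_closedBall hv (mem_sphere_zero_iff_norm.1 hz).le)
  refine le_of_sq_le_sq (norm_sq_le.trans_eq ?_) (by positivity)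
  rw [div_div, ← mul_pow, div_pow, ← pow_mul, mul_comm m 2, pow_mul (2 * s)]
  ring_nf

variable [FiniteDimensional ℂ E]

/- Off the exceptional set `N` the Gram kernel is bounded on the large ball, so pairing with `κ x`
gives the coefficient a factor `(64 s) ^ (-m)`, which beats the loss in passing from `N` to all of
the ball of radius `s / 2`. -/
theorem HasHolomorphicGram.norm_dualInner_taylorCoeff_le_of_exceptional
    [MeasurableSpace E] [BorelSpace E] (hκ : HasHolomorphicGram κ X) (μ : Measure E)
    [μ.IsAddHaarMeasure] [SMulInvariantMeasure Circle E μ] (hs : 0 < s) (hst : s < t)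
    (hX : closedBall b (64 * s) ⊆ X) (hκd : DifferentiableOn ℂ κ (ball b t)) (hQ : 1 ≤ Q)
    (hκQ : ∀ x ∈ ball b t, ‖κ x‖ ≤ Q)
    {N : Set E} (hN : ∀ x ∈ ball b s \ N, ∀ y ∈ closedBall b (64 * s), ‖dualInner (κ y) (κ x)‖ ≤ Q)
    (hμN : 2 * μ N ≤ μ (ball 0 (s / 2))) {v : E} (hv : ‖v‖ ≤ 1) (m : ℕ) {x : E}
    (hx : x ∈ closedBall b (s / 2)) :
    ‖dualInner (κ x) (taylorCoeff (fun z : ℂ => κ (b + z • v)) m)‖ ≤ Q ^ 2 / (8 * s) ^ m := by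
  have hsub : ball b s ⊆ ball b t := ball_subset_ball hst.le
  have hψ : AnalyticAt ℂ (fun z : ℂ => κ (b + z • v)) 0 :=
    (differentiableOn_line_of_lt hst hκd hv).analyticAt (closedBall_mem_nhds 0 hs)
  have norm_sq_le := norm_sq_le_mul_of_measure_exceptional_le μ (A := Q / (64 * s) ^ m)
    (B := Q * (Q / s ^ m)) hs (by positivity) ?_
    (differentiableOn_dualInner (hκd.mono hsub) (taylorCoeff (fun z : ℂ => κ (b + z • v)) m))
    (fun y hy => ?_) (fun y hy => ?_) hμN hx
  · refine le_of_sq_le_sq (norm_sq_le.trans ?_) (by positivity)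
    calc Q / (64 * s) ^ m * (Q * (Q / s ^ m)) = Q ^ 3 / (64 * s * s) ^ m := by
          rw [mul_pow (64 * s) s]
          field_simp
      _ = Q ^ 3 / (8 * s) ^ (m * 2) := by
          rw [pow_mul']
          ring_nf
      _ ≤ Q ^ 4 / (8 * s) ^ (m * 2) := by gcongr; norm_num
      _ = (Q ^ 2 / (8 * s) ^ m) ^ 2 := by rw [div_pow, ← pow_mul, ← pow_mul]
  · calc Q / (64 * s) ^ m ≤ Q / s ^ m := by gcongr; linarith
      _ ≤ Q * (Q / s ^ m) := le_mul_of_one_le_left (by positivity) hQ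
  · exact (norm_dualInner_le _ _).trans (mul_le_mul (hκQ y (hsub hy))
      (norm_taylorCoeff_line_le hs hst hκd hκQ hv m) (norm_nonneg _) (by positivity))
  · exact hκ.norm_dualInner_taylorCoeff_le hv (by positivity) hX hψ
      (hX (ball_subset_closedBall.trans (closedBall_subset_closedBall (by linarith)) hy.1))
      (hN y hy) m

theorem HasHolomorphicGram.exists_norm_le (hκ : HasHolomorphicGram κ X) (hs : 0 < s) (hst : s < t)
    (hX : closedBall b (64 * s) ⊆ X) (htX : ball b t ⊆ X) {C : ℝ}
    (hC : ∀ x ∈ ball b t, ‖κ x‖ ≤ C) : ∃ C', ∀ x ∈ closedBall b (3 / 2 * s), ‖κ x‖ ≤ C' := by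
  borelize E
  have : ProperSpace E := FiniteDimensional.proper ℂ E
  obtain ⟨μ, _, _⟩ := exists_isAddHaarMeasure_smulInvariantMeasure_circle E
  have hκd := hκ.differentiableOn_ball_of_norm_le htX hC
  have hsX : ball b s ⊆ X := (ball_subset_ball hst.le).trans htX
  have small := tendsto_measure_setOf_exists_lt (μ := μ) (U := ball b s)
    (S := closedBall b (64 * s)) (g := fun y x => ‖dualInner (κ y) (κ x)‖) isOpen_ball
    (fun y hy => (hκ.continuousOn_norm_dualInner (hX hy)).mono hsX)
    (fun x hx => hκ.bddAbove_norm_dualInner (isCompact_closedBall _ _) hX (hsX hx))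
    measure_ball_lt_top.ne
  have half_pos : 0 < μ (ball 0 (s / 2)) / 2 :=
    ENNReal.half_pos (measure_ball_pos μ 0 (by positivity)).ne'
  obtain ⟨M, hμM, hM, hCM⟩ := ((small.eventually (gt_mem_nhds half_pos)).and
    ((eventually_ge_atTop 1).and (tendsto_natCast_atTop_atTop.eventually_ge_atTop C))).exists
  have norm_coeff_le (v : E) (hv : ‖v‖ ≤ 1) (m : ℕ) :
      ‖taylorCoeff (fun z : ℂ => κ (b + z • v)) m‖ ≤ M / (2 * s) ^ m :=
    norm_taylorCoeff_line_le_of_dualInner hs hst hκd (Nat.cast_nonneg M) hv fun x hx =>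
      hκ.norm_dualInner_taylorCoeff_le_of_exceptional μ hs hst hX hκd (mod_cast hM)
        (fun x hx => (hC x hx).trans hCM)
        (fun x ⟨hx, hxN⟩ y hy => not_lt.1 fun hlt => hxN ⟨hx, y, hy, hlt⟩)
        ((mul_le_mul_right hμM.le 2).trans_eq
          (ENNReal.mul_div_cancel two_ne_zero ENNReal.ofNat_ne_top)) hv m hx
  exact ⟨_, fun x hx => hκ.norm_le_of_norm_taylorCoeff_le (ball_subset_closedBall.trans hX)
    (hκd.eventually_differentiableAt (ball_mem_nhds b (hs.trans hst))) norm_coeff_le (by linarith)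
    (by linarith) hx⟩

end Hartogs

section LocalBound

open Metric Set Filter Topology

theorem exists_norm_le_of_isCompact {α V : Type*} [TopologicalSpace α] [SeminormedAddCommGroup V]
    {f : α → V} {S : Set α} (hS : IsCompact S) (hf : ∀ x ∈ S, ∃ C, ∀ᶠ y in 𝓝 x, ‖f y‖ ≤ C) :
    ∃ C, ∀ x ∈ S, ‖f x‖ ≤ C := by
  refine hS.induction_on (p := fun S => ∃ C, ∀ x ∈ S, ‖f x‖ ≤ C) ⟨0, by simp⟩ ?_ ?_ ?_
  · exact fun S T hST ⟨C, hC⟩ => ⟨C, fun x hx => hC x (hST hx)⟩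
  · exact fun S T ⟨C, hC⟩ ⟨D, hD⟩ => ⟨max C D, fun x hx => hx.elim
      (fun h => (hC x h).trans (le_max_left C D)) fun h => (hD x h).trans (le_max_right C D)⟩
  · intro x hx
    obtain ⟨C, hC⟩ := hf x hx
    exact ⟨_, mem_nhdsWithin_of_mem_nhds hC, C, fun y hy => hy⟩

theorem isOpen_setOf_eventually_norm_le {α V : Type*} [TopologicalSpace α]
    [SeminormedAddCommGroup V] (f : α → V) : IsOpen {x | ∃ C, ∀ᶠ y in 𝓝 x, ‖f y‖ ≤ C} := by
  rw [isOpen_iff_mem_nhds]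
  rintro x ⟨C, hC⟩
  filter_upwards [eventually_eventually_nhds.2 hC] with y hy
  exact ⟨C, hy⟩

variable {E : Type*} [NormedAddCommGroup E] [NormedSpace ℂ E] [FiniteDimensional ℂ E]
  {F : Type*} [NormedAddCommGroup F] [InnerProductSpace ℂ F] [CompleteSpace F]
  {κ : E → StrongDual ℂ F} {X : Set E}

namespace HasHolomorphicGram

theorem exists_mem_ball_eventually_norm_le (hκ : HasHolomorphicGram κ X) {a : E} {ρ : ℝ}
    (hρ : 0 < ρ) (hX : closedBall a ρ ⊆ X) : ∃ b ∈ ball a ρ, ∃ C, ∀ᶠ y in 𝓝 b, ‖κ y‖ ≤ C := by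
  have : ProperSpace E := FiniteDimensional.proper ℂ E
  have hball : ball a ρ ⊆ X := ball_subset_closedBall.trans hX
  obtain ⟨b, hb, M, hM⟩ := exists_eventually_forall_le (U := ball a ρ) (S := closedBall a ρ)
    (g := fun y x => ‖dualInner (κ y) (κ x)‖) isOpen_ball ⟨a, mem_ball_self hρ⟩
    (fun y hy => (hκ.continuousOn_norm_dualInner (hX hy)).mono hball)
    fun x hx => hκ.bddAbove_norm_dualInner (isCompact_closedBall a ρ) hX (hball hx)
  refine ⟨b, hb, √M, ?_⟩
  filter_upwards [hM, isOpen_ball.mem_nhds hb] with y hy hyb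
  exact Real.le_sqrt_of_sq_le
    ((norm_dualInner_self (κ y)).symm.trans_le (hy y (ball_subset_closedBall hyb)))

/- A point of local boundedness near `a` lies at some distance `r` from the set of bad points;
the ball on which `exists_norm_le` bounds `κ` reaches past its nearest bad point. -/
theorem eventually_norm_le (hκ : HasHolomorphicGram κ X) (hXo : IsOpen X) {a : E} (ha : a ∈ X) :
    ∃ C, ∀ᶠ y in 𝓝 a, ‖κ y‖ ≤ C := by
  have : ProperSpace E := FiniteDimensional.proper ℂ E
  by_contra hna
  set Ω : Set E := {x | ∃ C, ∀ᶠ y in 𝓝 x, ‖κ y‖ ≤ C}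
  have hΩ : IsClosed Ωᶜ := (isOpen_setOf_eventually_norm_le κ).isClosed_compl
  obtain ⟨R, hR, hRX⟩ := nhds_basis_closedBall.mem_iff.1 (hXo.mem_nhds ha)
  obtain ⟨b, hba, hb⟩ := hκ.exists_mem_ball_eventually_norm_le (ρ := R / 100) (by positivity)
    ((closedBall_subset_closedBall (by linarith)).trans hRX)
  obtain ⟨a', ha', hr⟩ := hΩ.exists_infDist_eq_dist ⟨a, hna⟩ b
  set r := infDist b Ωᶜ
  have hr0 : 0 < r := (hΩ.notMem_iff_infDist_pos ⟨a, hna⟩).1 (not_not.2 hb)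
  have hrR : r < R / 100 := (infDist_le_dist_of_mem hna).trans_lt hba
  have hΩ_of_mem : ball b r ⊆ Ω := disjoint_compl_right_iff_subset.1 disjoint_ball_infDist
  have hbX {q : ℝ} (hq : q ≤ 64 * r) : closedBall b q ⊆ X :=
    (closedBall_subset_closedBall' (by linarith [mem_ball.1 hba])).trans hRX
  obtain ⟨C, hC⟩ := exists_norm_le_of_isCompact (isCompact_closedBall b (7 / 8 * r))
    fun x hx => hΩ_of_mem (closedBall_subset_ball (by linarith) hx)
  obtain ⟨C', hC'⟩ := hκ.exists_norm_le (b := b) (s := 3 / 4 * r) (t := 7 / 8 * r)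
    (by positivity) (by linarith) (hbX (by linarith))
    (ball_subset_closedBall.trans (hbX (by linarith))) fun x hx => hC x (ball_subset_closedBall hx)
  refine ha' ⟨C', ?_⟩
  filter_upwards [closedBall_mem_nhds_of_mem
    (show a' ∈ ball b (3 / 2 * (3 / 4 * r)) by rw [mem_ball, dist_comm]; linarith)] using hC'

theorem differentiableOn (hκ : HasHolomorphicGram κ X) (hXo : IsOpen X) :
    DifferentiableOn ℂ κ X := by
  intro a ha
  obtain ⟨C, hC⟩ := hκ.eventually_norm_le hXo ha
  obtain ⟨ρ, hρ, hsub⟩ := Metric.mem_nhds_iff.1 (inter_mem hC (hXo.mem_nhds ha))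
  exact (hκ.differentiableAt_of_norm_le hρ (hsub.trans inter_subset_right)
    fun x hx => (hsub hx).1).differentiableWithinAt

end HasHolomorphicGram

end LocalBound

section Identity

open Metric Set Filter Topology

variable {E : Type*} [NormedAddCommGroup E] [NormedSpace ℂ E]

theorem convex_preimage_line (b v : E) {S : Set E} (hS : Convex ℝ S) :
    Convex ℝ ((fun z : ℂ => b + z • v) ⁻¹' S) :=
  (hS.translate_preimage_right b).is_linear_preimage
    (((ContinuousLinearMap.toSpanSingleton ℂ v).restrictScalars ℝ).toLinearMap.isLinear)

theorem eq_zero_of_convex_of_eventuallyEq_zero {B : Set E} (hBo : IsOpen B) (hBc : Convex ℝ B)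
    {f : E → ℂ} (hf : DifferentiableOn ℂ f B) {b : E} (hb : b ∈ B) (hfb : f =ᶠ[𝓝 b] 0) {c : E}
    (hc : c ∈ B) : f c = 0 := by
  let L : ℂ → E := fun z => b + z • (c - b)
  have hL : Continuous L := by fun_prop
  have hfL : AnalyticOnNhd ℂ (f ∘ L) (L ⁻¹' B) :=
    (hf.comp (by fun_prop) (mapsTo_preimage L B)).analyticOnNhd (hBo.preimage hL)
  have hL0 : f ∘ L =ᶠ[𝓝 0] 0 := (hL.tendsto' 0 b (by simp [L])).eventually hfb
  simpa [L] using hfL.eqOn_zero_of_preconnected_of_eventuallyEq_zero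
    (convex_preimage_line b (c - b) hBc).isPreconnected (by simpa [L] using hb) hL0
    (by simpa [L] using hc : (1 : ℂ) ∈ L ⁻¹' B)

theorem eqOn_zero_of_isPreconnected_of_eventuallyEq_zero {X : Set E} (hXo : IsOpen X)
    (hXc : IsPreconnected X) {f : E → ℂ} (hf : DifferentiableOn ℂ f X) {a : E} (ha : a ∈ X)
    (hfa : f =ᶠ[𝓝 a] 0) : EqOn f 0 X := by
  suffices X ⊆ {x | f =ᶠ[𝓝 x] 0} from fun x hx => (this hx).eq_of_nhds
  refine hXc.subset_of_closure_inter_subset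
    (isOpen_iff_mem_nhds.2 fun x hx => eventually_eventually_nhds.2 hx) ⟨a, ha, hfa⟩ ?_
  rintro p ⟨hp, hpX⟩
  obtain ⟨ε, hε, hεX⟩ := Metric.isOpen_iff.1 hXo p hpX
  obtain ⟨b, hb, hfb⟩ := mem_closure_iff_nhds.1 hp _ (ball_mem_nhds p hε)
  filter_upwards [ball_mem_nhds p hε] with c hc
  exact eq_zero_of_convex_of_eventuallyEq_zero isOpen_ball (convex_ball p ε) (hf.mono hεX) hb hfb hc

theorem eqOn_of_isPreconnected_of_eqOn {X G : Set E} (hXo : IsOpen X) (hXc : IsPreconnected X)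
    {f g : E → ℂ} (hf : DifferentiableOn ℂ f X) (hg : DifferentiableOn ℂ g X) (hGo : IsOpen G)
    (hG : (X ∩ G).Nonempty) (hfg : EqOn f g G) : EqOn f g X := by
  obtain ⟨a, haX, haG⟩ := hG
  have hzero := eqOn_zero_of_isPreconnected_of_eventuallyEq_zero hXo hXc (hf.sub hg) haX
    ((hGo.eventually_mem haG).mono fun x hx => sub_eq_zero.2 (hfg hx))
  exact fun x hx => sub_eq_zero.1 (hzero hx)

end Identity

section Polarization

open Metric Set Filter Topology

theorem eqOn_zero_ball_of_forall_real {f : ℂ → ℂ} {ε : ℝ} (hf : DifferentiableOn ℂ f (ball 0 ε))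
    (hr : ∀ x : ℝ, (x : ℂ) ∈ ball 0 ε → f x = 0) : EqOn f 0 (ball 0 ε) := by
  intro z hz
  have hε : 0 < ε := pos_of_mem_ball hz
  have htend : Tendsto (fun x : ℝ => (x : ℂ)) (𝓝[≠] 0) (𝓝[≠] 0) :=
    Complex.continuous_ofReal.continuousWithinAt.tendsto_nhdsWithin fun x hx => by simpa using hx
  refine (hf.analyticOnNhd isOpen_ball).eqOn_zero_of_preconnected_of_frequently_eq_zero
    (convex_ball 0 ε).isPreconnected (mem_ball_self hε) (htend.frequently ?_) hz
  refine Eventually.frequently ?_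
  filter_upwards [mem_nhdsWithin_of_mem_nhds (ball_mem_nhds (0 : ℝ) hε)] with x hx
  exact hr x (by simpa using hx)

theorem eqOn_zero_ball_prod_of_forall_real {h : ℂ × ℂ → ℂ} {ε : ℝ}
    (hh : DifferentiableOn ℂ h (ball 0 ε))
    (hr : ∀ x y : ℝ, ((x : ℂ), (y : ℂ)) ∈ ball 0 ε → h (x, y) = 0) : EqOn h 0 (ball 0 ε) := by
  have mem_ball_iff {z w : ℂ} : (z, w) ∈ ball (0 : ℂ × ℂ) ε ↔ z ∈ ball 0 ε ∧ w ∈ ball 0 ε := by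
    simp [Prod.norm_def]
  rintro ⟨z, w⟩ hzw
  obtain ⟨hz, hw⟩ := mem_ball_iff.1 hzw
  refine eqOn_zero_ball_of_forall_real (f := fun w => h (z, w))
    (hh.comp (by fun_prop) fun w hw => mem_ball_iff.2 ⟨hz, hw⟩) (fun y hy => ?_) hw
  exact eqOn_zero_ball_of_forall_real (f := fun z => h (z, y))
    (hh.comp (by fun_prop) fun z hz => mem_ball_iff.2 ⟨hz, hy⟩)
    (fun x hx => hr x y (mem_ball_iff.2 ⟨hx, hy⟩)) hz

/- In the coordinates `(z, w) ↦ (s + (z + i w), conj s + (z - i w))` the antidiagonal is the set of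
real points. -/
theorem eventuallyEq_zero_of_antidiagonal {h : ℂ × ℂ → ℂ} {Q : Set (ℂ × ℂ)} (hQ : IsOpen Q)
    (hh : DifferentiableOn ℂ h Q) (hdiag : ∀ s, (s, conj s) ∈ Q → h (s, conj s) = 0) {s : ℂ}
    (hs : (s, conj s) ∈ Q) : h =ᶠ[𝓝 (s, conj s)] 0 := by
  let P : ℂ × ℂ → ℂ × ℂ := fun q => (s + (q.1 + Complex.I * q.2), conj s + (q.1 - Complex.I * q.2))
  let R : ℂ × ℂ → ℂ × ℂ := fun p =>
    (((p.1 - s) + (p.2 - conj s)) / 2, ((p.1 - s) - (p.2 - conj s)) / (2 * Complex.I))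
  have hPR (p : ℂ × ℂ) : P (R p) = p := by ext <;> simp only [P, R] <;> field_simp <;> ring
  have hP : Differentiable ℂ P := by fun_prop
  have hR : Tendsto R (𝓝 (s, conj s)) (𝓝 0) :=
    Continuous.tendsto' (by fun_prop) _ _ (by simp [R])
  obtain ⟨ε, hε, hεQ⟩ := Metric.mem_nhds_iff.1
    (hP.continuous.continuousAt.preimage_mem_nhds (x := 0) (hQ.mem_nhds (by simpa [P] using hs)))
  have hzero : EqOn (h ∘ P) 0 (ball 0 ε) := by
    refine eqOn_zero_ball_prod_of_forall_real (hh.comp hP.differentiableOn hεQ) fun x y hxy => ?_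
    have real_mem : P (x, y) = ((P (x, y)).1, conj (P (x, y)).1) := by simp [P]; ring
    have hmem : P (x, y) ∈ Q := hεQ hxy
    rw [Function.comp_apply, real_mem]
    exact hdiag _ (real_mem ▸ hmem)
  filter_upwards [hR.eventually (ball_mem_nhds 0 hε)] with p hp
  simpa only [Function.comp_apply, hPR, Pi.zero_apply] using hzero hp

theorem eq_zero_of_diagonal {D : Set ℂ} (hDo : IsOpen D) (hDc : IsPreconnected D) {g : ℂ → ℂ → ℂ}
    (hg : DifferentiableOn ℂ (fun p : ℂ × ℂ => g p.1 (conj p.2)) (D ×ˢ (starRingEnd ℂ ⁻¹' D)))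
    (hdiag : ∀ s ∈ D, g s s = 0) {s t : ℂ} (hs : s ∈ D) (ht : t ∈ D) : g s t = 0 := by
  have hDo' : IsOpen (starRingEnd ℂ ⁻¹' D) := hDo.preimage Complex.continuous_conj
  have hDc' : IsPreconnected (starRingEnd ℂ ⁻¹' D) :=
    (Complex.conjCLE.toHomeomorph.isPreconnected_preimage).2 hDc
  have hsQ : (s, conj s) ∈ D ×ˢ (starRingEnd ℂ ⁻¹' D) := ⟨hs, by simpa using hs⟩
  have hzero := eqOn_zero_of_isPreconnected_of_eventuallyEq_zero (hDo.prod hDo') (hDc.prod hDc') hg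
    hsQ (eventuallyEq_zero_of_antidiagonal (hDo.prod hDo') hg
      (fun s hs => by simpa using hdiag s hs.1) hsQ)
  simpa using hzero (⟨hs, by simpa using ht⟩ : (s, conj t) ∈ D ×ˢ (starRingEnd ℂ ⁻¹' D))

variable {F : Type*} [NormedAddCommGroup F] [InnerProductSpace ℂ F] [CompleteSpace F]

theorem differentiableOn_dualInner_conj {D : Set ℂ} (hD : IsOpen D) {α β : ℂ → StrongDual ℂ F}
    (hα : DifferentiableOn ℂ α D) (hβ : DifferentiableOn ℂ β D) :
    DifferentiableOn ℂ (fun p : ℂ × ℂ => dualInner (α p.1) (β (conj p.2)))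
      (D ×ˢ (starRingEnd ℂ ⁻¹' D)) := by
  simp only [dualInner_eq_apply]
  have hβ' : DifferentiableOn ℂ (fun τ => (InnerProductSpace.toDual ℂ F).symm (β (conj τ)))
      (starRingEnd ℂ ⁻¹' D) := fun τ hτ => by
    simpa [Function.comp_def] using
      ((hβ.differentiableAt (hD.mem_nhds hτ)).comp_semilinear₁ (starRingEnd ℂ)
        (InnerProductSpace.toDual ℂ F).symm.toContinuousLinearEquiv.toContinuousLinearMap
        ).differentiableWithinAt
  exact (hα.comp differentiableOn_fst fun p hp => hp.1).clm_apply
    (hβ'.comp differentiableOn_snd fun p hp => hp.2)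

theorem dualInner_eq_of_norm_eq {F' : Type*} [NormedAddCommGroup F'] [InnerProductSpace ℂ F']
    [CompleteSpace F'] {E : Type*} [NormedAddCommGroup E] [NormedSpace ℂ E] {B : Set E}
    (hBo : IsOpen B) (hBc : Convex ℝ B) {f : E → StrongDual ℂ F} {g : E → StrongDual ℂ F'}
    (hf : DifferentiableOn ℂ f B) (hg : DifferentiableOn ℂ g B) (hfg : ∀ x ∈ B, ‖f x‖ = ‖g x‖)
    {x y : E} (hx : x ∈ B) (hy : y ∈ B) : dualInner (f x) (f y) = dualInner (g x) (g y) := by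
  let L : ℂ → E := fun z => x + z • (y - x)
  have hL : Differentiable ℂ L := by fun_prop
  have hD : IsOpen (L ⁻¹' B) := hBo.preimage hL.continuous
  have hfL : DifferentiableOn ℂ (f ∘ L) (L ⁻¹' B) :=
    hf.comp hL.differentiableOn (mapsTo_preimage L B)
  have hgL : DifferentiableOn ℂ (g ∘ L) (L ⁻¹' B) :=
    hg.comp hL.differentiableOn (mapsTo_preimage L B)
  have key := eq_zero_of_diagonal hD (convex_preimage_line x (y - x) hBc).isPreconnected
    (g := fun s t => dualInner (f (L s)) (f (L t)) - dualInner (g (L s)) (g (L t)))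
    ((differentiableOn_dualInner_conj hD hfL hfL).fun_sub
      (differentiableOn_dualInner_conj hD hgL hgL))
    (fun s hs => by rw [dualInner_self, dualInner_self, hfg _ hs, sub_self])
    (s := 0) (t := 1) (by simpa [L] using hx) (by simpa [L] using hy)
  simpa [L, sub_eq_zero] using key

end Polarization

section ProjectiveCosine

variable {F : Type*} [NormedAddCommGroup F] [InnerProductSpace ℂ F] [CompleteSpace F]

/-- The cosine of the angle between the complex lines spanned by `g` and `h`, which determines both
`δ₁` and `δ₂`. -/
noncomputable def projectiveCosine (g h : StrongDual ℂ F) : ℝ :=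
  ‖dualInner g h‖ / (‖g‖ * ‖h‖)

theorem projectiveCosine_nonneg (g h : StrongDual ℂ F) : 0 ≤ projectiveCosine g h := by
  unfold projectiveCosine
  positivity

theorem projectiveCosine_le_one (g h : StrongDual ℂ F) : projectiveCosine g h ≤ 1 :=
  div_le_one_of_le₀ (norm_dualInner_le g h) (by positivity)

theorem left_ne_zero_of_dualInner_ne_zero {g h : StrongDual ℂ F} (hgh : dualInner g h ≠ 0) :
    g ≠ 0 := by
  rintro rfl
  simp [dualInner] at hgh

theorem right_ne_zero_of_dualInner_ne_zero {g h : StrongDual ℂ F} (hgh : dualInner g h ≠ 0) :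
    h ≠ 0 := by
  rintro rfl
  simp [dualInner] at hgh

theorem projectiveCosine_ne_zero_iff {g h : StrongDual ℂ F} :
    projectiveCosine g h ≠ 0 ↔ dualInner g h ≠ 0 := by
  refine ⟨fun hcos hgh => hcos (by simp [projectiveCosine, hgh]), fun hgh => ?_⟩
  have hg := norm_ne_zero_iff.2 (left_ne_zero_of_dualInner_ne_zero hgh)
  have hh := norm_ne_zero_iff.2 (right_ne_zero_of_dualInner_ne_zero hgh)
  exact div_ne_zero (norm_ne_zero_iff.2 hgh) (mul_ne_zero hg hh)

theorem projectiveCosine_sq_eq_norm_div (g h : StrongDual ℂ F) :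
    projectiveCosine g h ^ 2 =
      ‖dualInner h g / dualInner h h / (dualInner g g / dualInner g h)‖ := by
  simp only [projectiveCosine, norm_div, norm_dualInner_self, norm_dualInner_symm h g]
  field_simp

theorem delta₁_eq_sqrt_projectiveCosine (g h : StrongDual ℂ F) :
    delta₁ g h = √(1 - projectiveCosine g h ^ 2) := by
  rw [delta₁, projectiveCosine, div_pow, mul_pow]

theorem delta₂_eq_sqrt_projectiveCosine (g h : StrongDual ℂ F) :
    delta₂ g h = √(2 - 2 * projectiveCosine g h) :=
  rfl

theorem delta₁_eq_iff {g h g' h' : StrongDual ℂ F} :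
    delta₁ g' h' = delta₁ g h ↔ projectiveCosine g' h' = projectiveCosine g h := by
  rw [delta₁_eq_sqrt_projectiveCosine, delta₁_eq_sqrt_projectiveCosine, Real.sqrt_inj,
    sub_right_inj, sq_eq_sq₀ (projectiveCosine_nonneg _ _) (projectiveCosine_nonneg _ _)]
  · exact sub_nonneg.2 (pow_le_one₀ (projectiveCosine_nonneg _ _) (projectiveCosine_le_one _ _))
  · exact sub_nonneg.2 (pow_le_one₀ (projectiveCosine_nonneg _ _) (projectiveCosine_le_one _ _))

theorem delta₂_eq_iff {g h g' h' : StrongDual ℂ F} :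
    delta₂ g' h' = delta₂ g h ↔ projectiveCosine g' h' = projectiveCosine g h := by
  rw [delta₂_eq_sqrt_projectiveCosine, delta₂_eq_sqrt_projectiveCosine,
    Real.sqrt_inj (by linarith [projectiveCosine_le_one g' h'])
      (by linarith [projectiveCosine_le_one g h]),
    sub_right_inj, mul_right_inj' two_ne_zero]

end ProjectiveCosine

section FubiniStudy

open Metric Set Filter Topology

variable {F F' : Type*} [NormedAddCommGroup F] [InnerProductSpace ℂ F] [CompleteSpace F]
  [NormedAddCommGroup F'] [InnerProductSpace ℂ F'] [CompleteSpace F']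

/-- The Fubini–Study form with its base point polarized: `⟨g, g⟩` is replaced by `⟨g, h⟩`, so that
along holomorphic curves the expression is holomorphic in `(g, f₁)` and antiholomorphic in
`(h, f₂)`. -/
noncomputable def polarizedFubiniStudy (g f₁ h f₂ : StrongDual ℂ F) : ℂ :=
  dualInner f₁ f₂ / dualInner g h - dualInner f₁ h * dualInner g f₂ / dualInner g h ^ 2

theorem fubiniStudy_eq_polarizedFubiniStudy (g f₁ f₂ : StrongDual ℂ F) :
    fubiniStudy g f₁ f₂ = polarizedFubiniStudy g f₁ g f₂ := by
  rw [fubiniStudy, polarizedFubiniStudy, dualInner_self]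
  ring

theorem hasDerivAt_dualInner_left {k : ℂ → StrongDual ℂ F} {k' : StrongDual ℂ F} {s : ℂ}
    (hk : HasDerivAt k k' s) (h : StrongDual ℂ F) :
    HasDerivAt (fun s => dualInner (k s) h) (dualInner k' h) s := by
  simpa [dualInner_eq_apply] using hk.clm_apply (hasDerivAt_const s _)

theorem hasDerivAt_dualInner_div_dualInner {k : ℂ → StrongDual ℂ F} {k' : StrongDual ℂ F} {s : ℂ}
    (hk : HasDerivAt k k' s) {h : StrongDual ℂ F} (hh : dualInner (k s) h ≠ 0)
    (f : StrongDual ℂ F) :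
    HasDerivAt (fun s => dualInner (k s) f / dualInner (k s) h)
      (polarizedFubiniStudy (k s) k' h f) s := by
  refine ((hasDerivAt_dualInner_left hk f).fun_div (hasDerivAt_dualInner_left hk h) hh).congr_deriv
    ?_
  rw [polarizedFubiniStudy]
  field_simp

theorem logDeriv_dualInner_div_dualInner {k : ℂ → StrongDual ℂ F} {s : ℂ}
    (hk : DifferentiableAt ℂ k s) {f h : StrongDual ℂ F} (hf : dualInner (k s) f ≠ 0)
    (hh : dualInner (k s) h ≠ 0) :
    logDeriv (fun s => dualInner (k s) f / dualInner (k s) h) s =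
      dualInner (deriv k s) f / dualInner (k s) f -
        dualInner (deriv k s) h / dualInner (k s) h := by
  have hderiv := hasDerivAt_dualInner_left hk.hasDerivAt
  rw [logDeriv_div s hf hh (hderiv f).differentiableAt (hderiv h).differentiableAt, logDeriv_apply,
    logDeriv_apply, (hderiv f).deriv, (hderiv h).deriv]

theorem differentiableOn_polarizedFubiniStudy_conj {D : Set ℂ} (hD : IsOpen D)
    {k : ℂ → StrongDual ℂ F} (hk : DifferentiableOn ℂ k D)
    (hkn : ∀ s ∈ D, ∀ t ∈ D, dualInner (k s) (k t) ≠ 0) :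
    DifferentiableOn ℂ (fun p : ℂ × ℂ => polarizedFubiniStudy (k p.1) (deriv k p.1) (k (conj p.2))
      (deriv k (conj p.2))) (D ×ˢ (starRingEnd ℂ ⁻¹' D)) := by
  have hk' := hk.deriv hD
  have hgram := differentiableOn_dualInner_conj hD hk hk
  have hgram_ne : ∀ p ∈ D ×ˢ (starRingEnd ℂ ⁻¹' D), dualInner (k p.1) (k (conj p.2)) ≠ 0 :=
    fun p hp => hkn _ hp.1 _ hp.2
  simp only [polarizedFubiniStudy, div_eq_mul_inv]
  exact ((differentiableOn_dualInner_conj hD hk' hk').fun_mul (hgram.fun_inv hgram_ne)).fun_sub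
    (((differentiableOn_dualInner_conj hD hk' hk).fun_mul
      (differentiableOn_dualInner_conj hD hk hk')).fun_mul
      ((hgram.fun_pow 2).fun_inv fun p hp => pow_ne_zero 2 (hgram_ne p hp)))

section Curves

variable {D : Set ℂ} {k : ℂ → StrongDual ℂ F} {l : ℂ → StrongDual ℂ F'}

theorem polarizedFubiniStudy_eq_of_fubiniStudy_eq (hDo : IsOpen D) (hDc : IsPreconnected D)
    (hk : DifferentiableOn ℂ k D) (hl : DifferentiableOn ℂ l D)
    (hkn : ∀ s ∈ D, ∀ t ∈ D, dualInner (k s) (k t) ≠ 0)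
    (hln : ∀ s ∈ D, ∀ t ∈ D, dualInner (l s) (l t) ≠ 0)
    (hFS : ∀ s ∈ D, fubiniStudy (k s) (deriv k s) (deriv k s) =
      fubiniStudy (l s) (deriv l s) (deriv l s)) {s t : ℂ} (hs : s ∈ D) (ht : t ∈ D) :
    polarizedFubiniStudy (k s) (deriv k s) (k t) (deriv k t) =
      polarizedFubiniStudy (l s) (deriv l s) (l t) (deriv l t) := by
  refine sub_eq_zero.1 (eq_zero_of_diagonal hDo hDc
    (g := fun s t => polarizedFubiniStudy (k s) (deriv k s) (k t) (deriv k t) -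
      polarizedFubiniStudy (l s) (deriv l s) (l t) (deriv l t))
    ((differentiableOn_polarizedFubiniStudy_conj hDo hk hkn).fun_sub
      (differentiableOn_polarizedFubiniStudy_conj hDo hl hln)) (fun s hs => ?_) hs ht)
  rw [← fubiniStudy_eq_polarizedFubiniStudy, ← fubiniStudy_eq_polarizedFubiniStudy, hFS s hs,
    sub_self]

theorem dualInner_deriv_div_sub_eq_of_fubiniStudy_eq (hDo : IsOpen D) (hDc : IsPreconnected D)
    (hk : DifferentiableOn ℂ k D) (hl : DifferentiableOn ℂ l D)
    (hkn : ∀ s ∈ D, ∀ t ∈ D, dualInner (k s) (k t) ≠ 0)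
    (hln : ∀ s ∈ D, ∀ t ∈ D, dualInner (l s) (l t) ≠ 0)
    (hFS : ∀ s ∈ D, fubiniStudy (k s) (deriv k s) (deriv k s) =
      fubiniStudy (l s) (deriv l s) (deriv l s)) {s s₀ t : ℂ} (hs : s ∈ D) (hs₀ : s₀ ∈ D)
    (ht : t ∈ D) :
    dualInner (deriv k t) (k s) / dualInner (k t) (k s) -
        dualInner (deriv l t) (l s) / dualInner (l t) (l s) =
      dualInner (deriv k t) (k s₀) / dualInner (k t) (k s₀) -
        dualInner (deriv l t) (l s₀) / dualInner (l t) (l s₀) := by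
  let φ : ℂ → ℂ := fun s => dualInner (k s) (deriv k t) / dualInner (k s) (k t) -
    dualInner (l s) (deriv l t) / dualInner (l s) (l t)
  have hφ (s : ℂ) (hs : s ∈ D) : HasDerivAt φ 0 s := by
    have hks := (hk.differentiableAt (hDo.mem_nhds hs)).hasDerivAt
    have hls := (hl.differentiableAt (hDo.mem_nhds hs)).hasDerivAt
    refine ((hasDerivAt_dualInner_div_dualInner hks (hkn s hs t ht) (deriv k t)).fun_sub
      (hasDerivAt_dualInner_div_dualInner hls (hln s hs t ht) (deriv l t))).congr_deriv ?_
    rw [polarizedFubiniStudy_eq_of_fubiniStudy_eq hDo hDc hk hl hkn hln hFS hs ht, sub_self]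
  have hconst : φ s = φ s₀ := hDo.is_const_of_deriv_eq_zero hDc
    (fun s hs => (hφ s hs).differentiableAt.differentiableWithinAt) (fun s hs => (hφ s hs).deriv)
    hs hs₀
  simpa only [φ, map_sub, map_div₀, conj_dualInner] using congrArg conj hconst

theorem exists_dualInner_div_eq_mul_of_fubiniStudy_eq (hDo : IsOpen D) (hDc : IsPreconnected D)
    (hk : DifferentiableOn ℂ k D) (hl : DifferentiableOn ℂ l D)
    (hkn : ∀ s ∈ D, ∀ t ∈ D, dualInner (k s) (k t) ≠ 0)
    (hln : ∀ s ∈ D, ∀ t ∈ D, dualInner (l s) (l t) ≠ 0)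
    (hFS : ∀ s ∈ D, fubiniStudy (k s) (deriv k s) (deriv k s) =
      fubiniStudy (l s) (deriv l s) (deriv l s)) {s s₀ : ℂ} (hs : s ∈ D) (hs₀ : s₀ ∈ D) :
    ∃ z : ℂ, z ≠ 0 ∧ ∀ t ∈ D, dualInner (k t) (k s) / dualInner (k t) (k s₀) =
      z * (dualInner (l t) (l s) / dualInner (l t) (l s₀)) := by
  refine (logDeriv_eqOn_iff
    ((differentiableOn_dualInner hk _).fun_div (differentiableOn_dualInner hk _)
      fun t ht => hkn t ht s₀ hs₀)
    ((differentiableOn_dualInner hl _).fun_div (differentiableOn_dualInner hl _)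
      fun t ht => hln t ht s₀ hs₀) hDo hDc
    (fun t ht => div_ne_zero (hln t ht s hs) (hln t ht s₀ hs₀))
    (fun t ht => div_ne_zero (hkn t ht s hs) (hkn t ht s₀ hs₀))).1 fun t ht => ?_
  rw [logDeriv_dualInner_div_dualInner (hk.differentiableAt (hDo.mem_nhds ht)) (hkn t ht s hs)
      (hkn t ht s₀ hs₀),
    logDeriv_dualInner_div_dualInner (hl.differentiableAt (hDo.mem_nhds ht)) (hln t ht s hs)
      (hln t ht s₀ hs₀), sub_eq_sub_iff_sub_eq_sub]
  exact dualInner_deriv_div_sub_eq_of_fubiniStudy_eq hDo hDc hk hl hkn hln hFS hs hs₀ ht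

/- The value of `⟨k t, k s⟩ / ⟨k t, k s₀⟩` at `t = s₀` divided by its value at `t = s` is the
squared cosine. -/
theorem projectiveCosine_eq_of_fubiniStudy_eq (hDo : IsOpen D) (hDc : IsPreconnected D)
    (hk : DifferentiableOn ℂ k D) (hl : DifferentiableOn ℂ l D)
    (hkn : ∀ s ∈ D, ∀ t ∈ D, dualInner (k s) (k t) ≠ 0)
    (hln : ∀ s ∈ D, ∀ t ∈ D, dualInner (l s) (l t) ≠ 0)
    (hFS : ∀ s ∈ D, fubiniStudy (k s) (deriv k s) (deriv k s) =
      fubiniStudy (l s) (deriv l s) (deriv l s)) {s s₀ : ℂ} (hs : s ∈ D) (hs₀ : s₀ ∈ D) :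
    projectiveCosine (k s) (k s₀) = projectiveCosine (l s) (l s₀) := by
  obtain ⟨z, hz, h⟩ :=
    exists_dualInner_div_eq_mul_of_fubiniStudy_eq hDo hDc hk hl hkn hln hFS hs hs₀
  have hquot : dualInner (k s₀) (k s) / dualInner (k s₀) (k s₀) /
        (dualInner (k s) (k s) / dualInner (k s) (k s₀)) =
      dualInner (l s₀) (l s) / dualInner (l s₀) (l s₀) /
        (dualInner (l s) (l s) / dualInner (l s) (l s₀)) := by
    rw [h s₀ hs₀, h s hs, mul_div_mul_left _ _ hz]
  rw [← sq_eq_sq₀ (projectiveCosine_nonneg _ _) (projectiveCosine_nonneg _ _)]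
  calc projectiveCosine (k s) (k s₀) ^ 2
      = ‖dualInner (k s₀) (k s) / dualInner (k s₀) (k s₀) /
          (dualInner (k s) (k s) / dualInner (k s) (k s₀))‖ :=
        projectiveCosine_sq_eq_norm_div _ _
    _ = projectiveCosine (l s) (l s₀) ^ 2 := by rw [hquot, projectiveCosine_sq_eq_norm_div]

end Curves

theorem eventually_dualInner_ne_zero {E : Type*} [TopologicalSpace E] {q : E → StrongDual ℂ F}
    {a : E} (hq : ContinuousAt q a) (hqa : q a ≠ 0) :
    ∀ᶠ p : E × E in 𝓝 (a, a), dualInner (q p.1) (q p.2) ≠ 0 := by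
  have hgram : ContinuousAt (fun p : E × E => dualInner (q p.1) (q p.2)) (a, a) :=
    continuous_dualInner.continuousAt.comp (hq.prodMap hq)
  exact hgram.eventually_ne (dualInner_self_ne_zero hqa)

theorem eventually_projectiveCosine_eq_of_fubiniStudy_eq {E : Type*} [NormedAddCommGroup E]
    [NormedSpace ℂ E] {X : Set E} (hXo : IsOpen X) {κ : E → StrongDual ℂ F}
    {l : E → StrongDual ℂ F'} (hκ : DifferentiableOn ℂ κ X) (hl : DifferentiableOn ℂ l X) {a : E}
    (ha : a ∈ X) (hκa : κ a ≠ 0) (hla : l a ≠ 0)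
    (hFS : ∀ x ∈ X, ∀ u, fubiniStudy (κ x) (fderiv ℂ κ x u) (fderiv ℂ κ x u) =
      fubiniStudy (l x) (fderiv ℂ l x u) (fderiv ℂ l x u)) :
    ∀ᶠ x in 𝓝 a, projectiveCosine (κ x) (κ a) = projectiveCosine (l x) (l a) := by
  have hκd {x : E} (hx : x ∈ X) := hκ.differentiableAt (hXo.mem_nhds hx)
  have hld {x : E} (hx : x ∈ X) := hl.differentiableAt (hXo.mem_nhds hx)
  obtain ⟨ε, hε, hεX⟩ := Metric.eventually_nhds_iff.1
    ((eventually_dualInner_ne_zero (hκd ha).continuousAt hκa).and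
      ((eventually_dualInner_ne_zero (hld ha).continuousAt hla).and
        (continuousAt_fst.eventually (hXo.mem_nhds ha))))
  have hball {x y : E} (hx : x ∈ ball a ε) (hy : y ∈ ball a ε) := @hεX (x, y) (max_lt hx hy)
  filter_upwards [ball_mem_nhds a hε] with x hx
  let L : ℂ → E := fun z => a + z • (x - a)
  have hL (z : ℂ) : HasDerivAt L (x - a) z := by
    simpa [L] using ((hasDerivAt_id z).smul_const (x - a)).const_add a
  have hκL (z : ℂ) (hz : z ∈ L ⁻¹' ball a ε) :=
    (hκd (hball hz hz).2.2).hasFDerivAt.comp_hasDerivAt z (hL z)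
  have hlL (z : ℂ) (hz : z ∈ L ⁻¹' ball a ε) :=
    (hld (hball hz hz).2.2).hasFDerivAt.comp_hasDerivAt z (hL z)
  have key := projectiveCosine_eq_of_fubiniStudy_eq (k := κ ∘ L) (l := l ∘ L)
    (isOpen_ball.preimage (by fun_prop))
    (convex_preimage_line a (x - a) (convex_ball a ε)).isPreconnected
    (fun z hz => (hκL z hz).differentiableAt.differentiableWithinAt)
    (fun z hz => (hlL z hz).differentiableAt.differentiableWithinAt)
    (fun s hs t ht => (hball hs ht).1) (fun s hs t ht => (hball hs ht).2.1)
    (fun s hs => by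
      rw [(hκL s hs).deriv, (hlL s hs).deriv]
      exact hFS _ (hball hs hs).2.2 _)
    (s := 1) (s₀ := 0) (by simpa [L] using hx) (by simpa [L] using hε)
  simpa [L] using key

end FubiniStudy

section Proportionality

variable {F : Type*} [NormedAddCommGroup F] [NormedSpace ℂ F] {E : Type*} [NormedAddCommGroup E]
  [NormedSpace ℂ E] {X G : Set E}

theorem exists_smul_eq_of_isPreconnected_of_exists_smul_eq (hXo : IsOpen X)
    (hXc : IsPreconnected X) {f g : E → StrongDual ℂ F} (hf : DifferentiableOn ℂ f X)
    (hg : DifferentiableOn ℂ g X) (hgn : ∀ x ∈ X, g x ≠ 0) (hGo : IsOpen G)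
    (hG : (X ∩ G).Nonempty) (hfg : ∀ x ∈ G, ∃ c : ℂ, f x = c • g x) {x : E} (hx : x ∈ X) :
    ∃ c : ℂ, f x = c • g x := by
  have hprop (v w : F) : f x v * g x w = f x w * g x v := by
    refine eqOn_of_isPreconnected_of_eqOn hXo hXc (f := fun x => f x v * g x w)
      (g := fun x => f x w * g x v)
      ((hf.clm_apply (differentiableOn_const v)).fun_mul (hg.clm_apply (differentiableOn_const w)))
      ((hf.clm_apply (differentiableOn_const w)).fun_mul (hg.clm_apply (differentiableOn_const v)))
      hGo hG (fun y hy => ?_) hx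
    obtain ⟨c, hc⟩ := hfg y hy
    simp only [hc, smul_apply, smul_eq_mul]
    ring
  obtain ⟨w, hw⟩ := DFunLike.ne_iff.1 (hgn x hx)
  refine ⟨f x w / g x w, ?_⟩
  ext v
  rw [smul_apply, smul_eq_mul, div_mul_eq_mul_div, eq_div_iff hw, hprop]

theorem eq_zero_of_forall_apply_eq_zero (hXo : IsOpen X) (hXc : IsPreconnected X)
    {κ : E → StrongDual ℂ F} (hκ : DifferentiableOn ℂ κ X)
    (hκt : ∀ v, (∀ x ∈ X, κ x v = 0) → v = 0) (hGo : IsOpen G) (hG : (X ∩ G).Nonempty) {v : F}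
    (hv : ∀ x ∈ G, κ x v = 0) : v = 0 :=
  hκt v (eqOn_of_isPreconnected_of_eqOn hXo hXc (hκ.clm_apply (differentiableOn_const v))
    (differentiableOn_const 0) hGo hG hv)

end Proportionality

section Isometry

open Set

variable {F F' : Type*} [NormedAddCommGroup F] [InnerProductSpace ℂ F]
  [NormedAddCommGroup F'] [InnerProductSpace ℂ F']

theorem norm_linearCombination_eq_of_inner_eq {ι : Type*} {v : ι → F} {w : ι → F'}
    (hvw : ∀ i j, inner ℂ (v i) (v j) = inner ℂ (w i) (w j)) (c : ι →₀ ℂ) :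
    ‖Finsupp.linearCombination ℂ v c‖ = ‖Finsupp.linearCombination ℂ w c‖ := by
  rw [@norm_eq_sqrt_re_inner ℂ, @norm_eq_sqrt_re_inner ℂ]
  simp only [Finsupp.linearCombination_apply, Finsupp.sum, inner_sum, sum_inner, inner_smul_left,
    inner_smul_right, hvw]

variable [CompleteSpace F] [CompleteSpace F']

theorem denseRange_linearCombination_of_inner_eq_zero {ι : Type*} {v : ι → F}
    (hv : ∀ f, (∀ i, inner ℂ (v i) f = 0) → f = 0) :
    DenseRange (Finsupp.linearCombination ℂ v) := by
  have htop : (Submodule.span ℂ (range v)).topologicalClosure = ⊤ := by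
    rw [Submodule.topologicalClosure_eq_top_iff, Submodule.eq_bot_iff]
    exact fun f hf => hv f fun i => hf _ (Submodule.subset_span (mem_range_self i))
  rw [← Finsupp.range_linearCombination] at htop
  exact Submodule.dense_iff_topologicalClosure_eq_top.2 htop

theorem exists_linearIsometryEquiv_of_inner_eq {ι : Type*} {v : ι → F} {w : ι → F'}
    (hv : ∀ f, (∀ i, inner ℂ (v i) f = 0) → f = 0) (hw : ∀ f, (∀ i, inner ℂ (w i) f = 0) → f = 0)
    (hvw : ∀ i j, inner ℂ (v i) (v j) = inner ℂ (w i) (w j)) :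
    ∃ T : F ≃ₗᵢ[ℂ] F', ∀ i, T (v i) = w i := by
  have hdense := denseRange_linearCombination_of_inner_eq_zero hv
  have hnorm := norm_linearCombination_eq_of_inner_eq hvw
  refine ⟨(LinearEquiv.refl ℂ (ι →₀ ℂ)).extendOfIsometry (Finsupp.linearCombination ℂ v)
    (Finsupp.linearCombination ℂ w) hdense (denseRange_linearCombination_of_inner_eq_zero hw)
    fun c => (hnorm c).symm, fun i => ?_⟩
  have hextend := LinearMap.extendOfNorm_eq (f := Finsupp.linearCombination ℂ w) hdense
    ⟨1, fun c => by rw [one_mul, hnorm]⟩ (Finsupp.single i 1)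
  simp only [Finsupp.linearCombination_single, one_smul] at hextend
  exact hextend

theorem exists_linearIsometryEquiv_of_dualInner_eq {ι : Type*} {f : ι → StrongDual ℂ F}
    {g : ι → StrongDual ℂ F'} (hf : ∀ v, (∀ i, f i v = 0) → v = 0)
    (hg : ∀ v, (∀ i, g i v = 0) → v = 0)
    (hfg : ∀ i j, dualInner (f i) (f j) = dualInner (g i) (g j)) :
    ∃ T : F ≃ₗᵢ[ℂ] F', ∀ i v, g i (T v) = f i v := by
  obtain ⟨T, hT⟩ := exists_linearIsometryEquiv_of_inner_eq
    (v := fun i => (InnerProductSpace.toDual ℂ F).symm (f i))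
    (w := fun i => (InnerProductSpace.toDual ℂ F').symm (g i))
    (by simpa only [InnerProductSpace.toDual_symm_apply] using hf)
    (by simpa only [InnerProductSpace.toDual_symm_apply] using hg) hfg
  refine ⟨T, fun i v => ?_⟩
  rw [← InnerProductSpace.toDual_symm_apply, ← hT, T.inner_map_map,
    InnerProductSpace.toDual_symm_apply]

end Isometry

section Rigidity

open Metric Set Filter Topology

variable {F F' : Type*} [NormedAddCommGroup F] [InnerProductSpace ℂ F] [CompleteSpace F]
  [NormedAddCommGroup F'] [InnerProductSpace ℂ F'] [CompleteSpace F']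

theorem norm_smul_eq_of_projectiveCosine_eq {g h : StrongDual ℂ F} {g' h' : StrongDual ℂ F'}
    (hgh : dualInner g h ≠ 0) (hcos : projectiveCosine g h = projectiveCosine g' h') :
    ‖(‖h‖ * dualInner g' h') • g‖ = ‖(‖h'‖ * dualInner g h) • g'‖ := by
  have hgh' : dualInner g' h' ≠ 0 :=
    projectiveCosine_ne_zero_iff.1 (hcos ▸ projectiveCosine_ne_zero_iff.2 hgh)
  have hne {k : StrongDual ℂ F} (hk : k ≠ 0) : ‖k‖ ≠ 0 := norm_ne_zero_iff.2 hk
  have hne' {k : StrongDual ℂ F'} (hk : k ≠ 0) : ‖k‖ ≠ 0 := norm_ne_zero_iff.2 hk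
  rw [projectiveCosine, projectiveCosine, div_eq_div_iff
    (mul_ne_zero (hne (left_ne_zero_of_dualInner_ne_zero hgh))
      (hne (right_ne_zero_of_dualInner_ne_zero hgh)))
    (mul_ne_zero (hne' (left_ne_zero_of_dualInner_ne_zero hgh'))
      (hne' (right_ne_zero_of_dualInner_ne_zero hgh')))] at hcos
  simp only [norm_smul, norm_mul, Complex.norm_real, norm_norm]
  linear_combination -hcos

variable {E : Type*} [NormedAddCommGroup E] [NormedSpace ℂ E] {X U : Set E}
  {κ : E → StrongDual ℂ F} {l : E → StrongDual ℂ F'}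

theorem exists_ball_dualInner_ne_zero (hXo : IsOpen X) (hXc : IsPreconnected X)
    (hκ : DifferentiableOn ℂ κ X) (hUo : IsOpen U) (hU : U.Nonempty) (hUX : U ⊆ X) {p : E}
    (hp : p ∈ X) (hκp : κ p ≠ 0) :
    ∃ a ε, 0 < ε ∧ ball a ε ⊆ U ∧ ∀ x ∈ ball a ε, dualInner (κ x) (κ p) ≠ 0 := by
  have hκp' := differentiableOn_dualInner hκ (κ p)
  obtain ⟨a, haU, ha⟩ : ∃ a ∈ U, dualInner (κ a) (κ p) ≠ 0 := by
    by_contra! hzero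
    exact dualInner_self_ne_zero hκp (eqOn_of_isPreconnected_of_eqOn hXo hXc hκp'
      (differentiableOn_const 0) hUo (by rwa [inter_eq_right.2 hUX]) hzero hp)
  obtain ⟨ε, hε, hεU⟩ := Metric.mem_nhds_iff.1 (Filter.inter_mem (hUo.mem_nhds haU)
    ((hκp'.differentiableAt (hXo.mem_nhds (hUX haU))).continuousAt.eventually_ne ha))
  exact ⟨a, ε, hε, fun x hx => (hεU hx).1, fun x hx => (hεU hx).2⟩

theorem exists_dualInner_smul_eq_of_projectiveCosine_eq (hXo : IsOpen X) (hXc : IsPreconnected X)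
    (hκ : DifferentiableOn ℂ κ X) (hl : DifferentiableOn ℂ l X) (hUo : IsOpen U) (hU : U.Nonempty)
    (hUX : U ⊆ X) {p : E} (hp : p ∈ X) (hκp : κ p ≠ 0)
    (hcos : ∀ x ∈ U, projectiveCosine (κ x) (κ p) = projectiveCosine (l x) (l p)) :
    ∃ (G : Set E) (c d : E → ℂ), IsOpen G ∧ G.Nonempty ∧ G ⊆ U ∧ (∀ x ∈ G, c x ≠ 0 ∧ d x ≠ 0) ∧
      ∀ x ∈ G, ∀ y ∈ G, dualInner (c x • κ x) (c y • κ y) = dualInner (d x • l x) (d y • l y) := by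
  obtain ⟨a, ε, hε, hGU, hne⟩ := exists_ball_dualInner_ne_zero hXo hXc hκ hUo hU hUX hp hκp
  have hGX : ball a ε ⊆ X := hGU.trans hUX
  have hne' (x : E) (hx : x ∈ ball a ε) : dualInner (l x) (l p) ≠ 0 :=
    projectiveCosine_ne_zero_iff.1 (hcos x (hGU hx) ▸ projectiveCosine_ne_zero_iff.2 (hne x hx))
  have hlp : l p ≠ 0 := right_ne_zero_of_dualInner_ne_zero (hne' a (mem_ball_self hε))
  refine ⟨ball a ε, fun x => ‖κ p‖ * dualInner (l x) (l p), fun x => ‖l p‖ * dualInner (κ x) (κ p),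
    isOpen_ball, ⟨a, mem_ball_self hε⟩, hGU, fun x hx => ⟨?_, ?_⟩, fun x hx y hy => ?_⟩
  · exact mul_ne_zero (by simpa using hκp) (hne' x hx)
  · exact mul_ne_zero (by simpa using hlp) (hne x hx)
  · exact dualInner_eq_of_norm_eq isOpen_ball (convex_ball a ε)
      (((differentiableOn_dualInner (hl.mono hGX) _).const_mul _).fun_smul (hκ.mono hGX))
      (((differentiableOn_dualInner (hκ.mono hGX) _).const_mul _).fun_smul (hl.mono hGX))
      (fun z hz => norm_smul_eq_of_projectiveCosine_eq (hne z hz) (hcos z (hGU hz))) hx hy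

theorem exists_linearIsometryEquiv_of_projectiveCosine_eq (hXo : IsOpen X)
    (hXc : IsPreconnected X) (hκ : DifferentiableOn ℂ κ X) (hl : DifferentiableOn ℂ l X)
    (hκt : ∀ v, (∀ x ∈ X, κ x v = 0) → v = 0) (hlt : ∀ v, (∀ x ∈ X, l x v = 0) → v = 0)
    (hln : ∀ x ∈ X, l x ≠ 0) (hUo : IsOpen U) (hU : U.Nonempty) (hUX : U ⊆ X) {p : E} (hp : p ∈ X)
    (hκp : κ p ≠ 0)
    (hcos : ∀ x ∈ U, projectiveCosine (κ x) (κ p) = projectiveCosine (l x) (l p)) :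
    ∃ T : F' ≃ₗᵢ[ℂ] F, ∀ x ∈ X, ∃ c : ℂ,
      (κ x).comp (T.toContinuousLinearEquiv : F' →L[ℂ] F) = c • l x := by
  obtain ⟨G, c, d, hGo, hG, hGU, hcd, hgram⟩ :=
    exists_dualInner_smul_eq_of_projectiveCosine_eq hXo hXc hκ hl hUo hU hUX hp hκp hcos
  have hXG : (X ∩ G).Nonempty := by rwa [inter_eq_right.2 (hGU.trans hUX)]
  obtain ⟨T, hT⟩ := exists_linearIsometryEquiv_of_dualInner_eq (ι := G)
    (f := fun x => d x • l x) (g := fun x => c x • κ x)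
    (fun v hv => eq_zero_of_forall_apply_eq_zero hXo hXc hl hlt hGo hXG fun x hx => by
      simpa [(hcd x hx).2] using hv ⟨x, hx⟩)
    (fun v hv => eq_zero_of_forall_apply_eq_zero hXo hXc hκ hκt hGo hXG fun x hx => by
      simpa [(hcd x hx).1] using hv ⟨x, hx⟩)
    (fun x y => (hgram x x.2 y y.2).symm)
  refine ⟨T, fun x hx => exists_smul_eq_of_isPreconnected_of_exists_smul_eq hXo hXc
    (hκ.clm_comp (differentiableOn_const _)) hl hln hGo hXG (fun y hy => ⟨d y / c y, ?_⟩) hx⟩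
  ext v
  have hTy : c y * κ y (T v) = d y * l y v := by simpa using hT ⟨y, hy⟩ v
  simpa [div_mul_eq_mul_div, eq_div_iff (hcd y hy).1, mul_comm] using hTy

end Rigidity

section FubiniStudyInvariance

open InnerProductSpace Filter Topology

variable {F : Type*} [NormedAddCommGroup F] [InnerProductSpace ℂ F] [CompleteSpace F]

theorem dualInner_add_left (f g h : StrongDual ℂ F) :
    dualInner (f + g) h = dualInner f h + dualInner g h := by
  simp only [dualInner_eq_apply, add_apply]

theorem dualInner_smul_left (c : ℂ) (f h : StrongDual ℂ F) :
    dualInner (c • f) h = c * dualInner f h := by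
  simp only [dualInner_eq_apply, smul_apply, smul_eq_mul]

theorem dualInner_add_right (f g h : StrongDual ℂ F) :
    dualInner f (g + h) = dualInner f g + dualInner f h := by
  simp only [← conj_dualInner _ f, dualInner_add_left, map_add]

theorem dualInner_smul_right (c : ℂ) (f h : StrongDual ℂ F) :
    dualInner f (c • h) = conj c * dualInner f h := by
  simp only [← conj_dualInner _ f, dualInner_smul_left, map_mul]

theorem fubiniStudy_smul_add {c : ℂ} (hc : c ≠ 0) {g : StrongDual ℂ F} (hg : g ≠ 0) (α β : ℂ)
    (f h : StrongDual ℂ F) :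
    fubiniStudy (c • g) (c • f + α • g) (c • h + β • g) = fubiniStudy g f h := by
  have hgg := dualInner_self_ne_zero hg
  have hcc : conj c ≠ 0 := (map_ne_zero _).2 hc
  simp only [fubiniStudy_eq_polarizedFubiniStudy, polarizedFubiniStudy, dualInner_add_left,
    dualInner_add_right, dualInner_smul_left, dualInner_smul_right]
  field_simp
  ring

theorem dualInner_comp_unitary {W : F →L[ℂ] F} (hW : W ∈ unitary (F →L[ℂ] F))
    (f h : StrongDual ℂ F) : dualInner (f.comp W) (h.comp W) = dualInner f h := by
  have toDual_symm_comp (f : StrongDual ℂ F) :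
      (toDual ℂ F).symm (f.comp W) = star W ((toDual ℂ F).symm f) := by
    refine ext_inner_right ℂ fun v => ?_
    rw [toDual_symm_apply, ContinuousLinearMap.star_eq_adjoint,
      ContinuousLinearMap.adjoint_inner_left, toDual_symm_apply, ContinuousLinearMap.comp_apply]
  rw [dualInner, toDual_symm_comp, toDual_symm_comp,
    ContinuousLinearMap.inner_map_map_of_mem_unitary (Unitary.star_mem hW), dualInner]

theorem fubiniStudy_comp_unitary {W : F →L[ℂ] F} (hW : W ∈ unitary (F →L[ℂ] F))
    (g f h : StrongDual ℂ F) :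
    fubiniStudy (g.comp W) (f.comp W) (h.comp W) = fubiniStudy g f h := by
  simp only [fubiniStudy_eq_polarizedFubiniStudy, polarizedFubiniStudy, dualInner_comp_unitary hW]

theorem differentiableAt_of_eventuallyEq_smul {𝕜 E V : Type*} [NontriviallyNormedField 𝕜]
    [NormedAddCommGroup E] [NormedSpace 𝕜 E] [NormedAddCommGroup V] [NormedSpace 𝕜 V]
    [SeparatingDual 𝕜 V] {μ l : E → V} {c : E → 𝕜} {a : E} (hμ : DifferentiableAt 𝕜 μ a)
    (hl : DifferentiableAt 𝕜 l a) (hla : l a ≠ 0) (hμl : μ =ᶠ[𝓝 a] fun x => c x • l x) :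
    DifferentiableAt 𝕜 c a := by
  obtain ⟨φ, hφ⟩ := SeparatingDual.exists_ne_zero (R := 𝕜) hla
  have hφμ : DifferentiableAt 𝕜 (fun x => φ (μ x)) a := φ.differentiableAt.comp a hμ
  have hφl : DifferentiableAt 𝕜 (fun x => φ (l x)) a := φ.differentiableAt.comp a hl
  refine (hφμ.fun_mul (hφl.fun_inv hφ)).congr_of_eventuallyEq ?_
  filter_upwards [hμl, hφl.continuousAt.eventually_ne hφ] with x hx hφx
  rw [hx, map_smul, smul_eq_mul, mul_inv_cancel_right₀ hφx]

theorem fubiniStudy_fderiv_eq_of_eventuallyEq_smul {E : Type*} [NormedAddCommGroup E]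
    [NormedSpace ℂ E] {μ l : E → StrongDual ℂ F} {c : E → ℂ} {a : E}
    (hμ : DifferentiableAt ℂ μ a) (hl : DifferentiableAt ℂ l a) (hμa : μ a ≠ 0)
    (hμl : μ =ᶠ[𝓝 a] fun x => c x • l x) (u v : E) :
    fubiniStudy (μ a) (fderiv ℂ μ a u) (fderiv ℂ μ a v) =
      fubiniStudy (l a) (fderiv ℂ l a u) (fderiv ℂ l a v) := by
  obtain ⟨hca, hla⟩ : c a ≠ 0 ∧ l a ≠ 0 := smul_ne_zero_iff.1 (hμl.eq_of_nhds ▸ hμa)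
  have hc := differentiableAt_of_eventuallyEq_smul hμ hl hla hμl
  rw [hμl.fderiv_eq, hμl.eq_of_nhds, fderiv_fun_smul hc hl]
  exact fubiniStudy_smul_add hca hla _ _ _ _

theorem fubiniStudy_fderiv_eq_of_comp_unitary_eq_smul {E : Type*} [NormedAddCommGroup E]
    [NormedSpace ℂ E] {κ l : E → StrongDual ℂ F} {c : E → ℂ} {a : E} {W : F →L[ℂ] F}
    (hW : W ∈ unitary (F →L[ℂ] F)) (hκ : DifferentiableAt ℂ κ a) (hl : DifferentiableAt ℂ l a)
    (hκa : κ a ≠ 0) (hκl : (fun x => (κ x).comp W) =ᶠ[𝓝 a] fun x => c x • l x) (u v : E) :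
    fubiniStudy (κ a) (fderiv ℂ κ a u) (fderiv ℂ κ a v) =
      fubiniStudy (l a) (fderiv ℂ l a u) (fderiv ℂ l a v) := by
  have hκW : HasFDerivAt (fun x => (κ x).comp W)
      (((ContinuousLinearMap.compL ℂ F F ℂ).flip W).comp (fderiv ℂ κ a)) a :=
    ((ContinuousLinearMap.compL ℂ F F ℂ).flip W).hasFDerivAt.comp a hκ.hasFDerivAt
  have hκWa : (κ a).comp W ≠ 0 := left_ne_zero_of_dualInner_ne_zero <| by
    rw [dualInner_comp_unitary hW (κ a) (κ a)]
    exact dualInner_self_ne_zero hκa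
  rw [← fubiniStudy_fderiv_eq_of_eventuallyEq_smul hκW.differentiableAt hl hκWa hκl, hκW.fderiv]
  exact (fubiniStudy_comp_unitary hW _ _ _).symm

end FubiniStudyInvariance

section ReproducingKernel

variable {X : Type*} {F : Type*} [NormedAddCommGroup F] [InnerProductSpace ℂ F] [CompleteSpace F]
  [RKHS ℂ F X ℂ] {K : X → X → ℂ}

theorem IsRescaling.normalizedSq_eq {M L : X → X → ℂ} (h : IsRescaling M L)
    (hM : ∀ x, M x x ≠ 0) (x y : X) : normalizedSq M x y = normalizedSq L x y := by
  obtain ⟨ω, hω⟩ := h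
  have hω0 (x : X) : ω x ≠ 0 := left_ne_zero_of_mul (left_ne_zero_of_mul (hω x x ▸ hM x))
  have hx := hω0 x
  have hy := hω0 y
  simp only [normalizedSq, hω, norm_mul, RCLike.norm_conj, Complex.mul_conj']
  push_cast
  field_simp [norm_ne_zero_iff.2 hx, norm_ne_zero_iff.2 hy]

theorem eq_zero_of_forall_evalMap_apply_eq_zero {f : F} (hf : ∀ x : X, evalMap F x f = 0) :
    f = 0 :=
  RKHS.ext (fun x => by simpa [evalMap_apply] using hf x)

theorem IsWeightedComposition.evalMap_comp {W : F →L[ℂ] F} {ω : X → ℂ} {Φ : X → X}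
    (hW : IsWeightedComposition F W ω Φ) (x : X) :
    (evalMap F x).comp W = ω x • evalMap F (Φ x) := by
  ext f
  simp [evalMap_apply, hW f x]

namespace HasKernel

theorem dualInner_evalMap (hF : HasKernel F K) (x y : X) :
    dualInner (evalMap F x) (evalMap F y) = K x y := by
  rw [dualInner_eq_apply, evalMap_apply, evalMap, LinearIsometryEquiv.symm_apply_apply, hF]

theorem evalMap_ne_zero (hF : HasKernel F K) {x : X} (hx : K x x ≠ 0) : evalMap F x ≠ 0 :=
  left_ne_zero_of_dualInner_ne_zero (hF.dualInner_evalMap x x ▸ hx)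

theorem normalizedSq_eq_projectiveCosine_sq (hF : HasKernel F K) (x y : X) :
    normalizedSq K x y = (projectiveCosine (evalMap F x) (evalMap F y) ^ 2 : ℝ) := by
  rw [normalizedSq, ← hF.dualInner_evalMap, ← hF.dualInner_evalMap, ← hF.dualInner_evalMap,
    dualInner_self, dualInner_self, projectiveCosine]
  push_cast
  ring

theorem normalizedSq_eq_iff (hF : HasKernel F K) {x y x' y' : X} :
    normalizedSq K x' y' = normalizedSq K x y ↔
      projectiveCosine (evalMap F x') (evalMap F y') =
        projectiveCosine (evalMap F x) (evalMap F y) := by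
  rw [hF.normalizedSq_eq_projectiveCosine_sq, hF.normalizedSq_eq_projectiveCosine_sq,
    Complex.ofReal_inj, sq_eq_sq₀ (projectiveCosine_nonneg _ _) (projectiveCosine_nonneg _ _)]

theorem isRescaling_of_isWeightedComposition (hF : HasKernel F K) (hK : ∀ x, K x x ≠ 0)
    {Φ : X → X} {ω : X → ℂ} {W : F →L[ℂ] F} (hWω : IsWeightedComposition F W ω Φ)
    (hW : W ∈ unitary (F →L[ℂ] F)) : IsRescaling (fun x y => K (Φ x) (Φ y)) K := by
  have kernel_eq (x y : X) : K x y = ω x * conj (ω y) * K (Φ x) (Φ y) := by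
    rw [← hF.dualInner_evalMap, ← dualInner_comp_unitary hW, hWω.evalMap_comp, hWω.evalMap_comp,
      dualInner_smul_left, dualInner_smul_right, hF.dualInner_evalMap, mul_assoc]
  have hω (x : X) : ω x ≠ 0 := left_ne_zero_of_mul (left_ne_zero_of_mul (kernel_eq x x ▸ hK x))
  refine ⟨fun x => (ω x)⁻¹, fun x y => ?_⟩
  have hx := hω x
  have hy : conj (ω y) ≠ 0 := (map_ne_zero _).2 (hω y)
  rw [kernel_eq x y, map_inv₀]
  field_simp

end HasKernel

end ReproducingKernel

section Domain

open Filter Topology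

variable {n : ℕ} {X : Set (EuclideanSpace ℂ (Fin n))}

theorem ext_coe {V : Type*} [Zero V] (f : X → V) (x : X) : ext f x = f x :=
  Subtype.val_injective.extend_apply f 0 x

theorem IsHolomorphic.hasFDerivAt {V : Type*} [NormedAddCommGroup V] [NormedSpace ℂ V] {f : X → V}
    (hf : IsHolomorphic f) (hXo : IsOpen X) (x : X) :
    HasFDerivAt (ext f) (differential f x) x :=
  (hf.differentiableAt (hXo.mem_nhds x.2)).hasFDerivAt

theorem IsHolomorphic.hasFDerivAt_ext_comp {V : Type*} [NormedAddCommGroup V] [NormedSpace ℂ V]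
    {f : X → V} (hf : IsHolomorphic f) (hXo : IsOpen X) {Φ : X → X}
    (hΦ : IsHolomorphic fun x => (Φ x : EuclideanSpace ℂ (Fin n))) (x : X) :
    HasFDerivAt (ext (f ∘ Φ)) ((differential f (Φ x)).comp
      (differential (fun z => (Φ z : EuclideanSpace ℂ (Fin n))) x)) x := by
  have hfΦ := hf.hasFDerivAt hXo (Φ x)
  rw [← ext_coe (fun z => (Φ z : EuclideanSpace ℂ (Fin n))) x] at hfΦ
  have hcomp := hfΦ.comp (x : EuclideanSpace ℂ (Fin n)) (hΦ.hasFDerivAt hXo x)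
  refine hcomp.congr_of_eventuallyEq ?_
  filter_upwards [hXo.mem_nhds x.2] with z hz
  lift z to X using hz
  simp only [Function.comp_apply, ext_coe]

theorem IsHolomorphic.comp {V : Type*} [NormedAddCommGroup V] [NormedSpace ℂ V] {f : X → V}
    (hf : IsHolomorphic f) (hXo : IsOpen X) {Φ : X → X}
    (hΦ : IsHolomorphic fun x => (Φ x : EuclideanSpace ℂ (Fin n))) : IsHolomorphic (f ∘ Φ) :=
  fun x hx => (hf.hasFDerivAt_ext_comp hXo hΦ ⟨x, hx⟩).differentiableAt.differentiableWithinAt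

variable {F : Type*} [NormedAddCommGroup F] [InnerProductSpace ℂ F] [CompleteSpace F]
  [RKHS ℂ F X ℂ] {K : X → X → ℂ}

theorem pullbackFubiniStudy_differential (hXo : IsOpen X) (hκ : IsHolomorphic (evalMap (X := X) F))
    {Φ : X → X} (hΦ : IsHolomorphic fun x => (Φ x : EuclideanSpace ℂ (Fin n))) (x : X)
    (u v : EuclideanSpace ℂ (Fin n)) :
    pullbackFubiniStudy F (Φ x) (differential (fun z => (Φ z : EuclideanSpace ℂ (Fin n))) x u)
        (differential (fun z => (Φ z : EuclideanSpace ℂ (Fin n))) x v) =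
      fubiniStudy (evalMap F (Φ x)) (fderiv ℂ (ext (evalMap F ∘ Φ)) x u)
        (fderiv ℂ (ext (evalMap F ∘ Φ)) x v) := by
  rw [(hκ.hasFDerivAt_ext_comp hXo hΦ x).fderiv]
  rfl

theorem pullbackFubiniStudy_eq_of_isWeightedComposition (hXo : IsOpen X)
    (hκ : IsHolomorphic (evalMap (X := X) F)) (hκ0 : ∀ x : X, evalMap F x ≠ 0) {Φ : X → X}
    (hΦ : IsHolomorphic fun x => (Φ x : EuclideanSpace ℂ (Fin n))) {ω : X → ℂ} {W : F →L[ℂ] F}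
    (hWω : IsWeightedComposition F W ω Φ) (hW : W ∈ unitary (F →L[ℂ] F)) (x : X)
    (u v : EuclideanSpace ℂ (Fin n)) :
    pullbackFubiniStudy F (Φ x) (differential (fun z => (Φ z : EuclideanSpace ℂ (Fin n))) x u)
        (differential (fun z => (Φ z : EuclideanSpace ℂ (Fin n))) x v) =
      pullbackFubiniStudy F x u v := by
  have hκW : (fun z => (ext (evalMap (X := X) F) z).comp W) =ᶠ[𝓝 (x : EuclideanSpace ℂ (Fin n))]
      fun z => ext ω z • ext (evalMap F ∘ Φ) z := by
    filter_upwards [hXo.mem_nhds x.2] with z hz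
    lift z to X using hz
    simpa only [ext_coe] using! hWω.evalMap_comp z
  have hFS := fubiniStudy_fderiv_eq_of_comp_unitary_eq_smul hW
    (hκ.hasFDerivAt hXo x).differentiableAt ((hκ.comp hXo hΦ).hasFDerivAt hXo x).differentiableAt
    (by simpa only [ext_coe] using hκ0 x) hκW u v
  simp only [ext_coe, Function.comp_apply] at hFS
  rw [pullbackFubiniStudy_differential hXo hκ hΦ, ← hFS]
  rfl

namespace HasKernel

theorem isHolomorphic_evalMap (hF : HasKernel F K) (hXo : IsOpen X) (hKs : IsSesquiHolomorphic K) :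
    IsHolomorphic (evalMap (X := X) F) := by
  have holomorphicGram : HasHolomorphicGram (ext (evalMap (X := X) F)) X := by
    intro y hy
    refine (hKs.1 ⟨y, hy⟩).congr fun x hx => ?_
    lift x to X using hx
    lift y to X using hy
    simp only [ext_coe, hF.dualInner_evalMap]
  exact holomorphicGram.differentiableOn hXo

theorem exists_normalizedSq_eq_of_pullbackFubiniStudy_eq (hF : HasKernel F K) (hXo : IsOpen X)
    (hK : ∀ x, K x x ≠ 0) (hκ : IsHolomorphic (evalMap (X := X) F)) {Φ : X → X}
    (hΦ : IsHolomorphic fun x => (Φ x : EuclideanSpace ℂ (Fin n)))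
    (hinv : ∀ (x : X) (u : EuclideanSpace ℂ (Fin n)),
      pullbackFubiniStudy F (Φ x) (differential (fun z => (Φ z : EuclideanSpace ℂ (Fin n))) x u)
        (differential (fun z => (Φ z : EuclideanSpace ℂ (Fin n))) x u) =
      pullbackFubiniStudy F x u u) (a : X) :
    ∃ U : Set X, IsOpen U ∧ a ∈ U ∧ ∀ x ∈ U, normalizedSq K (Φ x) (Φ a) = normalizedSq K x a := by
  have hcos := eventually_projectiveCosine_eq_of_fubiniStudy_eq hXo hκ (hκ.comp hXo hΦ) a.2
    (by simpa only [ext_coe] using hF.evalMap_ne_zero (hK a))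
    (by simpa only [ext_coe, Function.comp_apply] using hF.evalMap_ne_zero (hK (Φ a)))
    (fun x hx u => by
      lift x to X using hx
      simp only [ext_coe, Function.comp_apply]
      rw [← pullbackFubiniStudy_differential hXo hκ hΦ, hinv]
      rfl)
  obtain ⟨V, hV, hVo, haV⟩ := eventually_nhds_iff.1 hcos
  refine ⟨Subtype.val ⁻¹' V, hVo.preimage continuous_subtype_val, haV, fun x hx => ?_⟩
  have hx' := hV x hx
  simp only [ext_coe, Function.comp_apply] at hx'
  exact hF.normalizedSq_eq_iff.2 hx'.symm

theorem exists_unitary_isWeightedComposition (hF : HasKernel F K) (hXo : IsOpen X)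
    (hXc : IsPreconnected X) (hK : ∀ x, K x x ≠ 0) (hκ : IsHolomorphic (evalMap (X := X) F))
    {Φ : X ≃ X} (hΦ : IsHolomorphic fun x => (Φ x : EuclideanSpace ℂ (Fin n))) {y : X} {U : Set X}
    (hUo : IsOpen U) (hU : U.Nonempty)
    (hinv : ∀ x ∈ U, normalizedSq K (Φ x) (Φ y) = normalizedSq K x y) :
    ∃ (ω : X → ℂ) (W : F →L[ℂ] F), IsWeightedComposition F W ω Φ ∧ W ∈ unitary (F →L[ℂ] F) := by
  obtain ⟨T, hT⟩ := exists_linearIsometryEquiv_of_projectiveCosine_eq hXo hXc hκ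
    (hκ.comp hXo hΦ) (fun f hf => eq_zero_of_forall_evalMap_apply_eq_zero (X := X) fun x => by
      simpa only [ext_coe] using hf x x.2)
    (fun f hf => eq_zero_of_forall_evalMap_apply_eq_zero (X := X) fun x => by
      simpa [ext_coe] using hf (Φ.symm x) (Φ.symm x).2)
    (fun x hx => by
      lift x to X using hx
      simpa only [ext_coe, Function.comp_apply] using hF.evalMap_ne_zero (hK (Φ x)))
    (hXo.isOpenMap_subtype_val U hUo) (hU.image _) (Subtype.coe_image_subset X U) y.2
    (by simpa only [ext_coe] using hF.evalMap_ne_zero (hK y))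
    (by
      rintro _ ⟨x, hx, rfl⟩
      simpa only [ext_coe] using! (hF.normalizedSq_eq_iff.1 (hinv x hx)).symm)
  choose ω hω using fun x : X => hT x x.2
  refine ⟨ω, Unitary.linearIsometryEquiv.symm T, fun f x => ?_, Subtype.coe_prop _⟩
  have hx := DFunLike.congr_fun (hω x) f
  simpa [ext_coe, evalMap_apply] using hx

theorem pullbackDelta₁_eq_iff (hF : HasKernel F K) {x y x' y' : X} :
    pullbackDelta₁ F x' y' = pullbackDelta₁ F x y ↔ normalizedSq K x' y' = normalizedSq K x y := by
  rw [pullbackDelta₁, pullbackDelta₁, delta₁_eq_iff, hF.normalizedSq_eq_iff]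

theorem pullbackDelta₂_eq_iff (hF : HasKernel F K) {x y x' y' : X} :
    pullbackDelta₂ F x' y' = pullbackDelta₂ F x y ↔ normalizedSq K x' y' = normalizedSq K x y := by
  rw [pullbackDelta₂, pullbackDelta₂, delta₂_eq_iff, hF.normalizedSq_eq_iff]

end HasKernel

end Domain

end ProjectiveKernel

theorem mainTheorem2 {n : ℕ} {X : Set (EuclideanSpace ℂ (Fin n))}
    (hXo : IsOpen X) (hXc : IsConnected X)
    (K : X → X → ℂ)
    (hKs : ProjectiveKernel.IsSesquiHolomorphic K)
    (hKn : ProjectiveKernel.IsNondegenerate K)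
    (hKp : ProjectiveKernel.IsPosSemidefKernel K)
    (F : Type*) [NormedAddCommGroup F] [InnerProductSpace ℂ F] [CompleteSpace F]
    [RKHS ℂ F X ℂ] (hF : ProjectiveKernel.HasKernel F K) :
    List.TFAE [
      ProjectiveKernel.IsProjectivelyInvariant K,
      ∀ Φ : X ≃ X, ProjectiveKernel.IsAutomorphism Φ →
        ∃ (ω : X → ℂ) (W : F →L[ℂ] F),
          ProjectiveKernel.IsWeightedComposition F W ω Φ ∧ W ∈ unitary (F →L[ℂ] F),
      ProjectiveKernel.IsAutInvariantForm (ProjectiveKernel.pullbackFubiniStudy F),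
      ProjectiveKernel.IsAutInvariantDist (ProjectiveKernel.pullbackDelta₁ F),
      ProjectiveKernel.IsAutInvariantDist (ProjectiveKernel.pullbackDelta₂ F),
      ∀ Φ : X ≃ X, ProjectiveKernel.IsAutomorphism Φ →
        ∃ (y : X) (U : Set X), IsOpen U ∧ U.Nonempty ∧ ∀ x ∈ U,
          ProjectiveKernel.normalizedSq K (Φ x) (Φ y) = ProjectiveKernel.normalizedSq K x y] := by
  have hK (x : X) : K x x ≠ 0 := (hKn x).ne'
  have hκ := hF.isHolomorphic_evalMap hXo hKs
  obtain ⟨a⟩ := hXc.nonempty.to_subtype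
  tfae_have 1 → 4 := fun h Φ hΦ x y =>
    hF.pullbackDelta₁_eq_iff.2 ((h Φ hΦ).normalizedSq_eq (fun z => hK (Φ z)) x y)
  tfae_have 4 → 5 := fun h Φ hΦ x y =>
    hF.pullbackDelta₂_eq_iff.2 (hF.pullbackDelta₁_eq_iff.1 (h Φ hΦ x y))
  tfae_have 5 → 6 := fun h Φ hΦ =>
    ⟨a, Set.univ, isOpen_univ, ⟨a, trivial⟩, fun x _ => hF.pullbackDelta₂_eq_iff.1 (h Φ hΦ x a)⟩
  tfae_have 6 → 2 := fun h Φ hΦ => by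
    obtain ⟨y, U, hUo, hU, hinv⟩ := h Φ hΦ
    exact hF.exists_unitary_isWeightedComposition hXo hXc.isPreconnected hK hκ hΦ.1 hUo hU hinv
  tfae_have 2 → 1 := fun h Φ hΦ => by
    obtain ⟨ω, W, hWω, hW⟩ := h Φ hΦ
    exact hF.isRescaling_of_isWeightedComposition hK hWω hW
  tfae_have 2 → 3 := fun h Φ hΦ x u v => by
    obtain ⟨ω, W, hWω, hW⟩ := h Φ hΦ
    exact ProjectiveKernel.pullbackFubiniStudy_eq_of_isWeightedComposition hXo hκ
      (fun z => hF.evalMap_ne_zero (hK z)) hΦ.1 hWω hW x u v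
  tfae_have 3 → 6 := fun h Φ hΦ => by
    obtain ⟨U, hUo, haU, hU⟩ := hF.exists_normalizedSq_eq_of_pullbackFubiniStudy_eq hXo hK hκ hΦ.1
      (fun x u => h Φ hΦ x u u) a
    exact ⟨a, U, hUo, ⟨a, haU⟩, hU⟩
  tfae_finish
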